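/- Let $R$ be a commutative Noetherian ring, $M$ a finitely generated $R$-module and $I$ an ideal of $R$. For a submodule $N\subseteq M$ let $\mathrm{ir}_M(N)$ be the number of submodules in an irredundant decomposition of $N$ as an intersection of irreducible submodules of $M$, and let $\mathrm{Ir}_{M,I}$ denote the polynomial with rational coefficients such that $\mathrm{Ir}_{M,I}(n)=\mathrm{ir}_M(I^nM)$ for all sufficiently large $n$. Let $$\mathrm{bight}_M(I)=\max\{\dim_{R_{\mathfrak p}}M_{\mathfrak p}\mid \mathfrak p \text{ minimal in } \mathrm{Ass}_R(M/IM)\}.$$ Let $A_M(I)$ be the set of primes that lie in $\mathrm{Ass}_R(M/I^nM)$ for all large $n$. Let $G(I)=\bigoplus_{n\ge0}I^n/I^{n+1}$ and $G_M(I)=\bigoplus_{n\ge0}I^nM/I^{n+1}M$. If $R$ is local with maximal ideal $\mathfrak m$, put $\ell_M(I)=\dim_{G(I)}\bigl(G_M(I)/\mathfrak m G_M(I)\bigr)$; if $R$ is not local, let $\ell_M(I)$ be the maximum of $\ell_{M_{\mathfrak m}}(IR_{\mathfrak m})$ over the maximal ideals $\mathfrak m$ of $R$ that contain some $\mathfrak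 p\in A_M(I)$. (1) If $\ell_M(I)=\mathrm{bight}_M(I)$ and this number is at least $1$, then the polynomial $\mathrm{Ir}_{M,I}$ exists, is nonzero, and $$\deg \mathrm{Ir}_{M,I}=\ell_M(I)-1.$$ (2) In particular, if $R$ is local and $I$ is an equimultiple ideal, i.e. $\ell_R(I)=\mathrm{ht}(I)$, with $\mathrm{ht}(I)\ge 1$, then the polynomial $\mathrm{Ir}_{R,I}$ exists, is nonzero, and $$\deg \mathrm{Ir}_{R,I}=\mathrm{ht}(I)-1.$$ -/

import Mathlib

universe u v

set_option maxSynthPendingDepth 3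

namespace IrPoly

section Reducibility

variable {R : Type*} [CommRing R] {M : Type*} [AddCommGroup M] [Module R M]

/-- `s` is an irredundant irreducible decomposition of the submodule `N`: its members are
irreducible submodules (proper, and not an intersection of two strictly larger submodules),
they intersect in `N`, and none of them can be left out. -/
def IsIrredundantDecomposition (N : Submodule R M) (s : Finset (Submodule R M)) : Prop :=
  (∀ Q ∈ s, InfIrred Q) ∧ s.inf id = N ∧ ∀ t : Finset (Submodule R M), t ⊂ s → t.inf id ≠ N

/-- The index of reducibility `ir_M(N)`: the number of members of an irredundant irreducible
decomposition of `N`. For a Noetherian module such decompositions exist and they all have the same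
number of members, so the infimum below is that common number. -/
noncomputable def ir (N : Submodule R M) : ℕ :=
  sInf {k : ℕ | ∃ s : Finset (Submodule R M), IsIrredundantDecomposition N s ∧ s.card = k}

/-- The infimum defining `ir N` is over a nonempty set. -/
theorem exists_isIrredundantDecomposition [IsNoetherian R M] (N : Submodule R M) :
    ∃ s : Finset (Submodule R M), IsIrredundantDecomposition N s := by
  obtain ⟨s₀, h₀, h₁⟩ := exists_infIrred_decomposition N
  obtain ⟨s, ⟨hs, hN⟩, hmin⟩ := WellFounded.has_min (wellFounded_lt (α := Finset (Submodule R M)))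
    {s | (∀ Q ∈ s, InfIrred Q) ∧ s.inf id = N} ⟨s₀, fun Q hQ => h₁ hQ, h₀⟩
  exact ⟨s, hs, hN, fun t ht h => hmin t ⟨fun Q hQ => hs Q (ht.1 hQ), h⟩ ht⟩

variable (R M) in
/-- `P` is the polynomial `Ir_{M,I}`: `P(n) = ir_M(Iⁿ M)` for all large `n`. There is at most one
such `P`. -/
def IsIrPolynomial (I : Ideal R) (P : Polynomial ℚ) : Prop :=
  ∀ᶠ n : ℕ in Filter.atTop,
    (ir (I ^ n • (⊤ : Submodule R M)) : ℚ) = P.eval (n : ℚ)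

end Reducibility

section BigHeight

variable (R : Type*) [CommRing R] (M : Type*) [AddCommGroup M] [Module R M] (I : Ideal R)

/-- The big height of `I` on `M`: the maximum of `dim M_𝔭` over the minimal members `𝔭` of
`Ass (M / I M)` (it is `⊥` if `M = I M`). -/
noncomputable def bight : WithBot ℕ∞ :=
  ⨆ p : {p : PrimeSpectrum R //
      Minimal (fun q : Ideal R => q ∈ associatedPrimes R (M ⧸ (I • (⊤ : Submodule R M))))
        p.asIdeal},
    Module.supportDim (Localization.AtPrime p.1.asIdeal)
      (LocalizedModule.AtPrime p.1.asIdeal M)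

/-- `A_M(I)`, the set of primes associated to `M / Iⁿ M` for all large `n`. For `R` Noetherian and
`M` finitely generated it is the stable value of `Ass (M / Iⁿ M)`. -/
def stableAss : Set (Ideal R) :=
  {p | ∀ᶠ n : ℕ in Filter.atTop,
    p ∈ associatedPrimes R (M ⧸ (I ^ n • (⊤ : Submodule R M)))}

end BigHeight

section AnalyticSpread

variable (R : Type*) [CommRing R] (M : Type*) [AddCommGroup M] [Module R M] (I : Ideal R)

/-- The Rees module `⨁ₙ Iⁿ M tⁿ ⊆ M[t]`, a module over the Rees algebra `⨁ₙ Iⁿ tⁿ ⊆ R[t]`. -/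
abbrev ReesModule : Type _ := (I.stableFiltration (⊤ : Submodule R M)).submodule

/-- The extension of `I` to the Rees algebra, `⨁ₙ Iⁿ⁺¹ tⁿ`. -/
noncomputable def reesExt : Ideal (reesAlgebra I) := I.map (algebraMap R (reesAlgebra I))

/-- The associated graded ring `G(I) = ⨁ₙ Iⁿ / Iⁿ⁺¹`, the Rees algebra modulo the
extension of `I`. -/
def GrRing : Type _ := reesAlgebra I ⧸ reesExt R I

noncomputable instance : CommRing (GrRing R I) :=
  inferInstanceAs (CommRing (reesAlgebra I ⧸ reesExt R I))

noncomputable instance : Algebra R (GrRing R I) :=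
  inferInstanceAs (Algebra R (reesAlgebra I ⧸ reesExt R I))

/-- The associated graded module `G_M(I) = ⨁ₙ Iⁿ M / Iⁿ⁺¹ M` over `G(I)`, the Rees module modulo
`I` times it. -/
def GrModule : Type _ :=
  ReesModule R M I ⧸ (reesExt R I • (⊤ : Submodule (reesAlgebra I) (ReesModule R M I)))

noncomputable instance : AddCommGroup (GrModule R M I) :=
  inferInstanceAs (AddCommGroup
    (ReesModule R M I ⧸ (reesExt R I • (⊤ : Submodule (reesAlgebra I) (ReesModule R M I)))))

noncomputable instance : Module (GrRing R I) (GrModule R M I) :=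
  inferInstanceAs (Module (reesAlgebra I ⧸ reesExt R I)
    (ReesModule R M I ⧸ (reesExt R I • (⊤ : Submodule (reesAlgebra I) (ReesModule R M I)))))

/-- The analytic spread over a local ring: `dim_{G(I)} (G_M(I) / 𝔪 G_M(I))`. -/
noncomputable def localAnalyticSpread [IsLocalRing R] : WithBot ℕ∞ :=
  Module.supportDim (GrRing R I)
    (GrModule R M I ⧸
      ((IsLocalRing.maximalIdeal R).map (algebraMap R (GrRing R I)) •
        (⊤ : Submodule (GrRing R I) (GrModule R M I))))

open Classical in
/-- The analytic spread `ℓ_M(I)`. If `R` is not local it is the maximum of the local analytic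
spreads of `I R_𝔪` on `M_𝔪` over the maximal ideals `𝔪` that contain some `𝔭 ∈ A_M(I)`. -/
noncomputable def analyticSpread : WithBot ℕ∞ :=
  if _h : IsLocalRing R then localAnalyticSpread R M I
  else
    ⨆ m : {m : MaximalSpectrum R // ∃ p ∈ stableAss R M I, p ≤ m.asIdeal},
      localAnalyticSpread (Localization.AtPrime m.1.asIdeal)
        (LocalizedModule.AtPrime m.1.asIdeal M)
        (I.map (algebraMap R (Localization.AtPrime m.1.asIdeal)))

/-- An ideal `I` of a local ring is equimultiple if `ℓ(I) = ht(I)`. -/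
def IsEquimultiple [IsLocalRing R] : Prop :=
  analyticSpread R R I = (I.height : WithBot ℕ∞)

end AnalyticSpread

end IrPoly

/-!
The socles of the localizations at associated primes count irreducible components: `ir_M(N)` is the
sum over `p ∈ Ass(M/N)` of the length of the socle of `(M/N)_p`. Only finitely many primes are
associated to some `M/IⁿM`, so it suffices to study the socle length of `M_p/IⁿM_p` for one `p` at a
time. By Artin–Rees and Hilbert's theorem on graded modules it is eventually a polynomial in `n`.

Upper bound: if `ℓ_M(I) ≤ d`, then homogeneous parameters of the fibre cone lift to `d` elements
generating a reduction `K` of a power of `I`. This reduction localizes, and up to an eventually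
constant summand the socles form a finitely generated graded module over the Rees algebra of `K_p`,
so their Hilbert polynomial has degree less than `d`.

Lower bound: if `p` is minimal in `Ass(M/IM)`, then some power of the maximal ideal of `R_p` kills
`IⁿM_p/Iⁿ⁺¹M_p` for all `n`, and the part of a module killed by it has length at most a constant
times that of the socle. So if the socle lengths grow with degree less than `d`, the Hilbert–Samuel
polynomial of `M_p` has degree at most `d`, and `dim M_p ≤ d`.
-/

namespace IrPoly

section PolynomialGrowth

open Polynomial Filter

lemma degree_bernoulli_le (n : ℕ) : (Polynomial.bernoulli n).degree ≤ n := by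
  rw [Polynomial.bernoulli]
  refine (degree_sum_le _ _).trans (Finset.sup_le fun i _ => (degree_monomial_le _ _).trans ?_)
  exact_mod_cast Nat.sub_le n i

lemma exists_eval_add_one_sub_eval_eq {P : ℚ[X]} {d : ℕ} (hP : P.degree < d) :
    ∃ Q : ℚ[X], Q.degree < (d + 1 : ℕ) ∧ ∀ x : ℚ, Q.eval (x + 1) - Q.eval x = P.eval x := by
  refine ⟨∑ i ∈ P.support, C (P.coeff i / (i + 1)) * Polynomial.bernoulli (i + 1), ?_,
    fun x => ?_⟩
  · refine (degree_sum_le _ _).trans_lt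
      ((Finset.sup_lt_iff (WithBot.bot_lt_coe _)).2 fun i hi => ?_)
    have hid : i < d := by exact_mod_cast (le_degree_of_mem_supp i hi).trans_lt hP
    rw [← smul_eq_C_mul]
    refine (degree_smul_le _ _).trans_lt ((degree_bernoulli_le _).trans_lt ?_)
    exact_mod_cast Nat.succ_lt_succ hid
  · rw [eval_finsetSum, eval_finsetSum, ← Finset.sum_sub_distrib, eval_eq_sum, Polynomial.sum_def]
    refine Finset.sum_congr rfl fun i _ => ?_
    have hi : (i : ℚ) + 1 ≠ 0 := by positivity
    rw [eval_mul, eval_mul, eval_C, eval_C, ← mul_sub, add_comm x 1,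
      Polynomial.bernoulli_eval_one_add, add_sub_cancel_left, add_tsub_cancel_right,
      Nat.cast_succ, ← mul_assoc, div_mul_cancel₀ _ hi]

lemma degree_taylor_sub_lt {Q : ℚ[X]} {d : ℕ} (hQ : Q.degree < (d + 1 : ℕ)) (c : ℚ) :
    (taylor c Q - Q).degree < d := by
  rcases eq_or_ne Q 0 with rfl | h0
  · simp
  · have hle : Q.degree ≤ d := by
      rw [degree_eq_natDegree h0] at hQ ⊢
      exact_mod_cast Nat.lt_succ_iff.1 (by exact_mod_cast hQ)
    refine (degree_sub_lt_left (degree_taylor Q c) ((taylor_eq_zero c Q).not.2 h0)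
      (leadingCoeff_taylor c Q)).trans_le ?_
    rwa [degree_taylor]

lemma degree_le_of_eventually_le {P Q : ℚ[X]} (h₀ : ∀ᶠ n : ℕ in atTop, 0 ≤ P.eval (n : ℚ))
    (h : ∀ᶠ n : ℕ in atTop, P.eval (n : ℚ) ≤ Q.eval (n : ℚ)) : P.degree ≤ Q.degree := by
  by_contra! hlt
  have hP : P ≠ 0 := ne_zero_of_degree_gt hlt
  have hratio : Tendsto (fun n : ℕ => Q.eval (n : ℚ) / P.eval (n : ℚ)) atTop (nhds 0) :=
    (div_tendsto_atTop_zero_of_degree_lt Q P hlt).comp tendsto_natCast_atTop_atTop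
  have hne : ∀ᶠ n : ℕ in atTop, P.eval (n : ℚ) ≠ 0 :=
    tendsto_natCast_atTop_atTop.eventually (P.eventually_atTop_not_isRoot hP)
  obtain ⟨n, hn₀, hn, hn', hn₁⟩ :=
    (h₀.and (h.and (hne.and (hratio.eventually (gt_mem_nhds one_pos))))).exists
  rw [div_lt_one (hn₀.lt_of_ne' hn')] at hn₁
  exact hn₁.not_ge hn

lemma degree_lt_of_degree_comp_C_mul_X_lt {P : ℚ[X]} {d : ℕ} {a : ℚ} (ha : a ≠ 0)
    (h : (P.comp (C a * X)).degree < d) : P.degree < d := by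
  rw [degree_lt_iff_coeff_zero] at h ⊢
  exact fun m hm => by simpa [ha] using h m hm

/-- `P` is the Hilbert polynomial of the function `f`: for all large `n` the value `f n` is finite
and equal to `P(n)`. -/
def IsHilbertPolynomial (f : ℕ → ℕ∞) (P : ℚ[X]) : Prop :=
  ∀ᶠ n : ℕ in atTop, ∃ k : ℕ, f n = k ∧ (k : ℚ) = P.eval (n : ℚ)

/-- `f` is of polynomial growth of degree less than `d`: it is eventually finite and bounded above
by such a polynomial. Only the zero function, eventually, has this property for `d = 0`. -/
def PolyBounded (d : ℕ) (f : ℕ → ℕ∞) : Prop :=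
  ∃ P : ℚ[X], P.degree < d ∧ ∀ᶠ n : ℕ in atTop, ∃ k : ℕ, f n = k ∧ (k : ℚ) ≤ P.eval (n : ℚ)

variable {f g : ℕ → ℕ∞} {P Q : ℚ[X]} {d : ℕ}

namespace IsHilbertPolynomial

lemma congr (hf : IsHilbertPolynomial f P) (h : ∀ᶠ n in atTop, f n = g n) :
    IsHilbertPolynomial g P := by
  filter_upwards [hf, h] with n hn hfg
  rwa [← hfg]

lemma const (k : ℕ) : IsHilbertPolynomial (fun _ => k) (C (k : ℚ)) :=
  Eventually.of_forall fun _ => ⟨k, rfl, eval_C.symm⟩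

lemma add (hf : IsHilbertPolynomial f P) (hg : IsHilbertPolynomial g Q) :
    IsHilbertPolynomial (fun n => f n + g n) (P + Q) := by
  filter_upwards [hf, hg] with n ⟨k, hk, hkP⟩ ⟨l, hl, hlQ⟩
  exact ⟨k + l, by rw [hk, hl, Nat.cast_add], by rw [Nat.cast_add, eval_add, hkP, hlQ]⟩

lemma sum {ι : Type*} {s : Finset ι} {f : ι → ℕ → ℕ∞} {P : ι → ℚ[X]}
    (h : ∀ i ∈ s, IsHilbertPolynomial (f i) (P i)) :
    IsHilbertPolynomial (fun n => ∑ i ∈ s, f i n) (∑ i ∈ s, P i) := by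
  classical
  induction s using Finset.induction_on with
  | empty => simpa using const 0
  | insert i s hi ih =>
    simp only [Finset.sum_insert hi]
    exact (h i (s.mem_insert_self i)).add (ih fun j hj => h j (Finset.mem_insert_of_mem hj))

lemma comp_add (hf : IsHilbertPolynomial f P) (c : ℕ) :
    IsHilbertPolynomial (fun n => f (n + c)) (taylor (c : ℚ) P) := by
  filter_upwards [(tendsto_add_atTop_nat c).eventually hf] with n ⟨k, hk, hkP⟩
  exact ⟨k, hk, by rw [hkP, taylor_eval, Nat.cast_add]⟩

lemma of_comp_add {c : ℕ} (hf : IsHilbertPolynomial (fun n => f (n + c)) P) :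
    IsHilbertPolynomial f (taylor (-c : ℚ) P) := by
  filter_upwards [(tendsto_sub_atTop_nat c).eventually hf, eventually_ge_atTop c]
    with n ⟨k, hk, hkP⟩ hn
  rw [Nat.sub_add_cancel hn] at hk
  exact ⟨k, hk, by rw [hkP, taylor_eval, Nat.cast_sub hn, sub_eq_add_neg]⟩

lemma comp_mul (hf : IsHilbertPolynomial f P) {e : ℕ} (he : e ≠ 0) :
    IsHilbertPolynomial (fun n => f (e * n)) (P.comp (C (e : ℚ) * X)) := by
  filter_upwards [(tendsto_id.const_mul_atTop' (Nat.pos_of_ne_zero he)).eventually hf]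
    with n ⟨k, hk, hkP⟩
  refine ⟨k, hk, ?_⟩
  rw [hkP, id, eval_comp, eval_mul, eval_C, eval_X, Nat.cast_mul]

lemma eventually_eval_nonneg (hf : IsHilbertPolynomial f P) :
    ∀ᶠ n : ℕ in atTop, 0 ≤ P.eval (n : ℚ) :=
  hf.mono fun _ ⟨k, _, hk⟩ => hk ▸ k.cast_nonneg

lemma polyBounded (hf : IsHilbertPolynomial f P) (hP : P.degree < d) : PolyBounded d f :=
  ⟨P, hP, hf.mono fun _ ⟨k, hk, hkP⟩ => ⟨k, hk, hkP.le⟩⟩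

lemma exists_of_add_eq {a b : ℕ → ℕ∞} {A B : ℚ[X]} (ha : IsHilbertPolynomial a A)
    (hA : A.degree < d) (hb : IsHilbertPolynomial b B) (hB : B.degree < d) (hf : ∀ n, f n ≠ ⊤)
    (h : ∀ n, f (n + 1) + a n = f n + b n) :
    ∃ P : ℚ[X], P.degree < (d + 1 : ℕ) ∧ IsHilbertPolynomial f P := by
  obtain ⟨Q, hQ, hQ_diff⟩ := exists_eval_add_one_sub_eval_eq
    ((degree_sub_le B A).trans_lt (max_lt hB hA))
  obtain ⟨c, hc⟩ := eventually_atTop.1 (ha.and hb)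
  lift f to ℕ → ℕ using hf
  refine ⟨Q + C (f c - Q.eval (c : ℚ)), ?_, eventually_atTop.2 ⟨c, fun n hn => ⟨f n, rfl, ?_⟩⟩⟩
  · refine (degree_add_le _ _).trans_lt (max_lt hQ (degree_C_le.trans_lt ?_))
    exact_mod_cast d.succ_pos
  · induction n, hn using Nat.le_induction with
    | base => simp
    | succ n hn ih =>
      obtain ⟨⟨k, hk, hkA⟩, l, hl, hlB⟩ := hc n hn
      have hstep : f (n + 1) + k = f n + l := by
        have hstep := h n
        simp only [hk, hl] at hstep
        exact_mod_cast hstep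
      have hstep' : (f (n + 1) : ℚ) + k = f n + l := by exact_mod_cast hstep
      have hdiff := hQ_diff n
      rw [eval_sub, ← hkA, ← hlB] at hdiff
      rw [eval_add, eval_C] at ih ⊢
      push_cast
      linarith

lemma polyBounded_of_add_le (hf : IsHilbertPolynomial f P) (hP : P.degree < (d + 1 : ℕ)) {c : ℕ}
    (h : ∀ n, f n + g n ≤ f (n + c)) : PolyBounded d g := by
  refine ⟨taylor (c : ℚ) P - P, degree_taylor_sub_lt hP c, ?_⟩
  filter_upwards [hf, hf.comp_add c] with n ⟨k, hk, hkP⟩ ⟨l, hl, hlP⟩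
  have hle := h n
  rw [hk, hl] at hle
  lift g n to ℕ using ne_top_of_le_ne_top (ENat.natCast_ne_top l) (le_add_self.trans hle) with m
  have hle' : (k : ℚ) + m ≤ l := by exact_mod_cast hle
  exact ⟨m, rfl, by rw [eval_sub, ← hkP, ← hlP]; linarith⟩

end IsHilbertPolynomial

namespace PolyBounded

lemma mono (hg : PolyBounded d g) (h : ∀ᶠ n in atTop, f n ≤ g n) : PolyBounded d f := by
  obtain ⟨P, hP, hgP⟩ := hg
  refine ⟨P, hP, ?_⟩
  filter_upwards [hgP, h] with n ⟨k, hk, hkP⟩ hn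
  rw [hk] at hn
  lift f n to ℕ using ne_top_of_le_ne_top (ENat.natCast_ne_top k) hn with j
  exact ⟨j, rfl, le_trans (by exact_mod_cast hn) hkP⟩

lemma comp_add (hf : PolyBounded d f) (c : ℕ) : PolyBounded d fun n => f (n + c) := by
  obtain ⟨P, hP, hfP⟩ := hf
  refine ⟨taylor (c : ℚ) P, by rwa [degree_taylor], ?_⟩
  filter_upwards [(tendsto_add_atTop_nat c).eventually hfP] with n ⟨k, hk, hkP⟩
  exact ⟨k, hk, by rwa [taylor_eval, ← Nat.cast_add]⟩

lemma const_mul (hf : PolyBounded d f) (c : ℕ) : PolyBounded d fun n => c * f n := by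
  obtain ⟨P, hP, hfP⟩ := hf
  refine ⟨(c : ℚ) • P, (degree_smul_le _ _).trans_lt hP, ?_⟩
  filter_upwards [hfP] with n ⟨k, hk, hkP⟩
  refine ⟨c * k, by rw [hk, Nat.cast_mul], ?_⟩
  rw [Nat.cast_mul, eval_smul, smul_eq_mul]
  exact mul_le_mul_of_nonneg_left hkP c.cast_nonneg

lemma of_le_add (hg : PolyBounded d g) (hf : ∀ n, f n ≠ ⊤) (h : ∀ n, f (n + 1) ≤ f n + g n) :
    PolyBounded (d + 1) f := by
  obtain ⟨P, hP, hgP⟩ := hg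
  obtain ⟨Q, hQ, hQ_diff⟩ := exists_eval_add_one_sub_eval_eq hP
  obtain ⟨c, hc⟩ := eventually_atTop.1 hgP
  lift f to ℕ → ℕ using hf
  refine ⟨Q + C (f c - Q.eval (c : ℚ)), ?_, eventually_atTop.2 ⟨c, fun n hn => ⟨f n, rfl, ?_⟩⟩⟩
  · refine (degree_add_le _ _).trans_lt (max_lt hQ (degree_C_le.trans_lt ?_))
    exact_mod_cast d.succ_pos
  · induction n, hn using Nat.le_induction with
    | base => simp
    | succ n hn ih =>
      obtain ⟨k, hk, hkP⟩ := hc n hn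
      have hstep := h n
      simp only [hk] at hstep
      have hstep' : (f (n + 1) : ℚ) ≤ f n + k := by exact_mod_cast hstep
      have hdiff := hQ_diff n
      rw [eval_add, eval_C] at ih ⊢
      push_cast
      linarith

lemma degree_lt (hf : PolyBounded d f) (hP : IsHilbertPolynomial f P) : P.degree < d := by
  obtain ⟨Q, hQ, hfQ⟩ := hf
  refine (degree_le_of_eventually_le hP.eventually_eval_nonneg ?_).trans_lt hQ
  filter_upwards [hP, hfQ] with n ⟨k, hk, hkP⟩ ⟨l, hl, hlQ⟩
  obtain rfl : k = l := by exact_mod_cast hk.symm.trans hl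
  exact hkP ▸ hlQ

lemma degree_lt_of_comp_mul {e : ℕ} (hf : PolyBounded d fun n => f (e * n)) (he : e ≠ 0)
    (hP : IsHilbertPolynomial f P) : P.degree < d :=
  degree_lt_of_degree_comp_C_mul_X_lt (Nat.cast_ne_zero.2 he) (hf.degree_lt (hP.comp_mul he))

lemma eventually_eq_zero (hf : PolyBounded 0 f) : ∀ᶠ n in atTop, f n = 0 := by
  obtain ⟨P, hP, hfP⟩ := hf
  obtain rfl : P = 0 := degree_eq_bot.1 (Nat.WithBot.lt_zero_iff.1 hP)
  filter_upwards [hfP] with n ⟨k, hk, hkP⟩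
  rw [eval_zero] at hkP
  rw [hk, Nat.cast_eq_zero.1 (hkP.antisymm k.cast_nonneg), Nat.cast_zero]

lemma ne_top (hf : PolyBounded d f) (hmono : Monotone f) (n : ℕ) : f n ≠ ⊤ := by
  obtain ⟨P, -, hfP⟩ := hf
  obtain ⟨m, ⟨k, hk, -⟩, hm⟩ := (hfP.and (eventually_ge_atTop n)).exists
  exact ne_top_of_le_ne_top (hk ▸ ENat.natCast_ne_top k) (hmono hm)

end PolyBounded

end PolynomialGrowth

section RelLen

variable {R : Type*} [CommRing R] {N : Type*} [AddCommGroup N] [Module R N]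
  {N' : Type*} [AddCommGroup N'] [Module R N'] {L L' K U U' : Submodule R N}

/-- The length of the subquotient `(U + L) / L` of a module; `L` need not be contained in `U`. -/
noncomputable def relLen (L U : Submodule R N) : ℕ∞ := Module.length R (U.map L.mkQ)

lemma relLen_comap (f : N →ₗ[R] N') (L : Submodule R N') (U : Submodule R N) :
    relLen (L.comap f) U = relLen L (U.map f) := by
  have hinj : Function.Injective ((L.comap f).mapQ L f le_rfl) := by
    rw [← LinearMap.ker_eq_bot, Submodule.ker_mapQ, Submodule.mkQ_map_self]
  rw [relLen, relLen, (Submodule.equivMapOfInjective _ hinj (U.map (L.comap f).mkQ)).length_eq,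
    ← Submodule.map_comp, ← Submodule.map_comp, Submodule.mapQ_mkQ]

lemma relLen_add (h₁ : L ≤ K) (h₂ : K ≤ U) : relLen L U = relLen L K + relLen K U := by
  let π : U.map L.mkQ →ₗ[R] U.map K.mkQ := (Submodule.factor h₁).restrict
    (by rintro _ ⟨x, hx, rfl⟩; exact ⟨x, hx, rfl⟩)
  refine Module.length_eq_add_of_exact (Submodule.inclusion (Submodule.map_mono h₂)) π
    (Submodule.inclusion_injective _) ?_ ?_
  · rintro ⟨_, x, hx, rfl⟩
    exact ⟨⟨L.mkQ x, x, hx, rfl⟩, rfl⟩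
  · rintro ⟨_, x, hx, rfl⟩
    rw [← Subtype.val_inj]
    change K.mkQ x = 0 ↔ _
    rw [Submodule.mkQ_apply, Submodule.Quotient.mk_eq_zero, Set.mem_range]
    refine ⟨fun hxK => ⟨⟨L.mkQ x, x, hxK, rfl⟩, rfl⟩, ?_⟩
    rintro ⟨⟨_, y, hy, rfl⟩, hyx⟩
    have hsub : y - x ∈ L := (Submodule.Quotient.eq L).1 (congrArg Subtype.val hyx)
    exact (K.sub_mem_iff_right hy).1 (h₁ hsub)

lemma relLen_eq_zero : relLen L U = 0 ↔ U ≤ L := by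
  rw [relLen, Module.length_eq_zero_iff, Submodule.subsingleton_iff_eq_bot,
    ← LinearMap.le_ker_iff_map, Submodule.ker_mkQ]

lemma relLen_mono_right (L : Submodule R N) (h : U ≤ U') : relLen L U ≤ relLen L U' :=
  Module.length_le_of_injective (Submodule.inclusion (Submodule.map_mono h))
    (Submodule.inclusion_injective _)

lemma relLen_sup_left (L U : Submodule R N) : relLen L (L ⊔ U) = relLen L U := by
  rw [relLen, relLen, Submodule.map_sup, Submodule.mkQ_map_self, bot_sup_eq]

lemma relLen_inf_left (L U : Submodule R N) : relLen (L ⊓ U) U = relLen L U := by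
  rw [← U.range_subtype, ← Submodule.map_top, ← relLen_comap, ← relLen_comap, Submodule.comap_inf,
    Submodule.map_top, U.range_subtype, Submodule.comap_subtype_self, inf_top_eq]

lemma relLen_anti_left (U : Submodule R N) (h : L ≤ L') : relLen L' U ≤ relLen L U := by
  rw [← relLen_inf_left L' U, ← relLen_inf_left L U,
    relLen_add (inf_le_inf_right U h) inf_le_right]
  exact le_add_self

lemma relLen_le_add (L K U : Submodule R N) : relLen L U ≤ relLen L K + relLen K U :=
  calc relLen L U ≤ relLen L (L ⊔ K ⊔ U) := relLen_mono_right _ le_sup_right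
    _ = relLen L K + relLen (L ⊔ K) U := by
      rw [relLen_add (le_sup_left : L ≤ L ⊔ K) le_sup_left, relLen_sup_left, relLen_sup_left]
    _ ≤ relLen L K + relLen K U := add_le_add_right (relLen_anti_left _ le_sup_right) _

lemma relLen_eq_add_of_le (U : Submodule R N) (h : L ≤ K) :
    relLen L U = relLen L (K ⊓ U) + relLen K U := by
  rw [← relLen_inf_left L U, relLen_add (inf_le_inf_right U h) inf_le_right, relLen_inf_left K U,
    ← relLen_inf_left L (K ⊓ U), ← inf_assoc, inf_eq_left.2 h]

lemma relLen_congr_of_le (h₁ : K ≤ U) (h₂ : U ≤ K ⊔ L) : relLen L U = relLen L K := by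
  refine le_antisymm ?_ (relLen_mono_right _ h₁)
  rw [← relLen_sup_left L K, sup_comm]
  exact relLen_mono_right _ h₂

end RelLen

section HilbertPolynomial

open Polynomial Filter

variable {R : Type*} [CommRing R] {N : Type*} [AddCommGroup N] [Module R N]

lemma smul_pow_smul_eq (J : Ideal R) (n : ℕ) (W : Submodule R N) :
    J • J ^ n • W = J ^ (n + 1) • W := by
  rw [pow_succ', mul_smul]

lemma antitone_pow_smul (J : Ideal R) (W : Submodule R N) : Antitone fun n : ℕ => J ^ n • W :=
  fun _ _ hmn => Submodule.smul_mono_left (Ideal.pow_le_pow_right hmn)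

lemma span_insert_smul (x : R) (s : Set R) (W : Submodule R N) :
    Ideal.span (insert x s) • W = W.map (LinearMap.lsmul R N x) ⊔ Ideal.span s • W := by
  rw [Ideal.span_insert, Submodule.sup_smul, Submodule.ideal_span_singleton_smul]
  rfl

lemma eventually_smul_eq_of_le [IsNoetherianRing R] [Module.Finite R N] {J : Ideal R}
    {W : Submodule R N} {K : ℕ → Submodule R N} (hK : Antitone K) (hJK : ∀ n, J • K n ≤ K (n + 1))
    (hW : ∀ n, K n ≤ J ^ n • W) : ∀ᶠ n in atTop, J • K n = K (n + 1) := by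
  let F : J.Filtration N := ⟨K, fun n => hK n.le_succ, hJK⟩
  exact eventually_atTop.2 ((J.stableFiltration_stable W).of_le (F' := F) hW)

/-- `⨁ₙ Uₙ / Lₙ` behaves like a finitely generated graded module over `⨁ₙ Jⁿ`: multiplication by
`J` maps the `n`-th component into the next one, and its image generates that component for large
`n`. As in `relLen`, the component of degree `n` is `(Uₙ + Lₙ) / Lₙ`. -/
structure IsStableSubquotient (J : Ideal R) (L U : ℕ → Submodule R N) : Prop where
  antitone_lower : Antitone L
  smul_lower_le : ∀ n, J • L n ≤ L (n + 1)
  smul_upper_le : ∀ n, J • U n ≤ U (n + 1)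
  eventually_upper_le : ∀ᶠ n in atTop, U (n + 1) ≤ J • U n ⊔ L (n + 1)

namespace IsStableSubquotient

variable {J : Ideal R} {L U : ℕ → Submodule R N}

lemma exists_relLen_eq_adic (h : IsStableSubquotient J L U) :
    ∃ c, ∀ n, relLen (L (n + c)) (U (n + c)) = relLen (L (n + c)) (J ^ n • U c) := by
  obtain ⟨c, hc⟩ := eventually_atTop.1 h.eventually_upper_le
  refine ⟨c, fun n => relLen_congr_of_le ?_ ?_⟩
  · induction n with
    | zero => simp
    | succ n ih =>
      rw [← smul_pow_smul_eq, Nat.add_right_comm]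
      exact (smul_mono_right J ih).trans (h.smul_upper_le _)
  · induction n with
    | zero => simp
    | succ n ih =>
      rw [← smul_pow_smul_eq, Nat.add_right_comm]
      refine (hc _ (Nat.le_add_left c n)).trans (sup_le ?_ le_sup_right)
      refine (smul_mono_right J ih).trans ?_
      rw [Submodule.smul_sup]
      exact sup_le_sup_left (h.smul_lower_le _) _

variable {x : R} {s : Set R} (hL : Antitone L)
  (hJL : ∀ n, Ideal.span (insert x s) • L n ≤ L (n + 1)) (W : Submodule R N)
include hL hJL

lemma ker_lsmul [IsNoetherianRing R] [Module.Finite R N] :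
    IsStableSubquotient (Ideal.span s) L fun n =>
      (L (n + 1)).comap (LinearMap.lsmul R N x) ⊓ Ideal.span (insert x s) ^ n • W := by
  set J := Ideal.span (insert x s)
  set K : ℕ → Submodule R N := fun n => (L (n + 1)).comap (LinearMap.lsmul R N x) ⊓ J ^ n • W
  have hsJ : Ideal.span s ≤ J := Ideal.span_mono (Set.subset_insert x s)
  have hK_anti : Antitone K := fun m n hmn =>
    inf_le_inf (Submodule.comap_mono (hL (Nat.succ_le_succ hmn))) (antitone_pow_smul J W hmn)
  have hJK : ∀ n, J • K n ≤ K (n + 1) := fun n => by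
    refine le_inf (Submodule.smul_le.2 fun b hb y hy => ?_) ?_
    · rw [Submodule.mem_comap, map_smul]
      exact hJL _ (Submodule.smul_mem_smul hb hy.1)
    · rw [← smul_pow_smul_eq]
      exact smul_mono_right J inf_le_right
  refine ⟨hL, fun n => (Submodule.smul_mono_left hsJ).trans (hJL n),
    fun n => (Submodule.smul_mono_left hsJ).trans (hJK n), ?_⟩
  filter_upwards [eventually_smul_eq_of_le hK_anti hJK fun n => inf_le_right] with n hn
  rw [← hn, span_insert_smul, sup_comm]
  exact sup_le_sup_left (Submodule.map_le_iff_le_comap.2 inf_le_left) _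

lemma coker_lsmul :
    IsStableSubquotient (Ideal.span s)
      (fun n => (Ideal.span (insert x s) ^ n • W).map (LinearMap.lsmul R N x) ⊔ L (n + 1))
      fun n => Ideal.span (insert x s) ^ (n + 1) • W := by
  set J := Ideal.span (insert x s)
  have hsJ : Ideal.span s ≤ J := Ideal.span_mono (Set.subset_insert x s)
  have hsV : ∀ n, Ideal.span s • J ^ n • W ≤ J ^ (n + 1) • W := fun n => by
    rw [← smul_pow_smul_eq]
    exact Submodule.smul_mono_left hsJ
  refine ⟨fun m n hmn => ?_, fun n => ?_, fun n => hsV (n + 1), Eventually.of_forall fun n => ?_⟩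
  · exact sup_le_sup (Submodule.map_mono (antitone_pow_smul J W hmn)) (hL (Nat.succ_le_succ hmn))
  · rw [Submodule.smul_sup, ← Submodule.map_smul'']
    exact sup_le_sup (Submodule.map_mono (hsV n)) ((Submodule.smul_mono_left hsJ).trans (hJL _))
  · rw [← smul_pow_smul_eq J (n + 1), span_insert_smul, sup_comm]
    exact sup_le_sup_left le_sup_left _

omit hL in
lemma relLen_add_relLen_ker_eq (n : ℕ) :
    relLen (L (n + 1)) (Ideal.span (insert x s) ^ (n + 1) • W) + relLen (L n)
        ((L (n + 1)).comap (LinearMap.lsmul R N x) ⊓ Ideal.span (insert x s) ^ n • W) =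
      relLen (L n) (Ideal.span (insert x s) ^ n • W) +
        relLen ((Ideal.span (insert x s) ^ n • W).map (LinearMap.lsmul R N x) ⊔ L (n + 1))
          (Ideal.span (insert x s) ^ (n + 1) • W) := by
  set J := Ideal.span (insert x s)
  set φ := LinearMap.lsmul R N x
  have hφL : L n ≤ (L (n + 1)).comap φ := fun y hy =>
    hJL n (Submodule.smul_mem_smul (Ideal.subset_span (Set.mem_insert x s)) hy)
  have hφW : (J ^ n • W).map φ ≤ J ^ (n + 1) • W := by
    rw [← smul_pow_smul_eq, span_insert_smul]
    exact le_sup_left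
  have himage : relLen (L (n + 1)) (((J ^ n • W).map φ ⊔ L (n + 1)) ⊓ J ^ (n + 1) • W) =
      relLen (L (n + 1)) ((J ^ n • W).map φ) :=
    relLen_congr_of_le (le_inf le_sup_left hφW) inf_le_left
  rw [relLen_eq_add_of_le (J ^ n • W) hφL, relLen_comap,
    relLen_eq_add_of_le (J ^ (n + 1) • W) (le_sup_right : L (n + 1) ≤ (J ^ n • W).map φ ⊔ _),
    himage]
  ring

end IsStableSubquotient

/-- As for graded modules, the kernel and the cokernel of multiplication by one of the generators
are handled by the remaining ones. -/
theorem IsStableSubquotient.exists_isHilbertPolynomial [IsNoetherianRing R] [Module.Finite R N]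
    {s : Finset R} {L U : ℕ → Submodule R N} (h : IsStableSubquotient (Ideal.span (s : Set R)) L U)
    (hfin : ∀ n, relLen (L n) (U n) ≠ ⊤) :
    ∃ P : ℚ[X], P.degree < s.card ∧ IsHilbertPolynomial (fun n => relLen (L n) (U n)) P := by
  classical
  induction s using Finset.induction_on generalizing L U with
  | empty =>
    refine ⟨_, by simp, IsHilbertPolynomial.of_comp_add (c := 1)
      ((IsHilbertPolynomial.const 0).congr ?_)⟩
    filter_upwards [h.eventually_upper_le] with n hn
    rw [Finset.coe_empty, Ideal.span_empty, Submodule.bot_smul, bot_sup_eq] at hn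
    exact (relLen_eq_zero.2 hn).symm
  | insert x s hx ih =>
    rw [Finset.coe_insert] at h
    obtain ⟨c, hc⟩ := h.exists_relLen_eq_adic
    set J := Ideal.span (insert x (s : Set R))
    set W := U c
    set Lc : ℕ → Submodule R N := fun n => L (n + c)
    have hLc : Antitone Lc := fun _ _ hmn => h.antitone_lower (Nat.add_le_add_right hmn c)
    have hJLc : ∀ n, J • Lc n ≤ Lc (n + 1) := fun n =>
      (h.smul_lower_le (n + c)).trans_eq (congrArg L (Nat.add_right_comm n c 1))
    have hfin' : ∀ n, relLen (Lc n) (J ^ n • W) ≠ ⊤ := fun n => hc n ▸ hfin (n + c)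
    obtain ⟨A, hA_deg, hA⟩ := ih (ker_lsmul hLc hJLc W) fun n =>
      ne_top_of_le_ne_top (hfin' n) (relLen_mono_right _ inf_le_right)
    obtain ⟨B, hB_deg, hB⟩ := ih (coker_lsmul hLc hJLc W) fun n =>
      ne_top_of_le_ne_top (hfin' (n + 1)) (relLen_anti_left _ le_sup_right)
    obtain ⟨P, hP_deg, hP⟩ := IsHilbertPolynomial.exists_of_add_eq hA hA_deg hB hB_deg hfin'
      (relLen_add_relLen_ker_eq hJLc W)
    rw [Finset.card_insert_of_notMem hx]
    exact ⟨_, (degree_taylor P _).trans_lt hP_deg,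
      IsHilbertPolynomial.of_comp_add (hP.congr (Eventually.of_forall fun n => (hc n).symm))⟩

end HilbertPolynomial

section HilbertSamuel

open Polynomial Filter

variable {R : Type*} [CommRing R] {N : Type*} [AddCommGroup N] [Module R N]
  {N' : Type*} [AddCommGroup N'] [Module R N'] {N'' : Type*} [AddCommGroup N''] [Module R N'']

/-- The Hilbert–Samuel function `n ↦ length (N / Iⁿ N)`. -/
noncomputable def samuel (I : Ideal R) (N : Type*) [AddCommGroup N] [Module R N] (n : ℕ) : ℕ∞ :=
  relLen (I ^ n • (⊤ : Submodule R N)) ⊤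

lemma samuel_zero (I : Ideal R) : samuel I N 0 = 0 := by
  rw [samuel, relLen_eq_zero, pow_zero, Submodule.one_smul]

lemma samuel_succ (I : Ideal R) (n : ℕ) : samuel I N (n + 1) =
    samuel I N n + relLen (I ^ (n + 1) • (⊤ : Submodule R N)) (I ^ n • ⊤) := by
  have hle : I ^ (n + 1) • (⊤ : Submodule R N) ≤ I ^ n • ⊤ := antitone_pow_smul I ⊤ n.le_succ
  rw [samuel, samuel, relLen_add hle le_top, add_comm]

lemma samuel_mono (I : Ideal R) : Monotone (samuel I N) :=
  monotone_nat_of_le_succ fun n => by rw [samuel_succ]; exact le_self_add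

lemma pow_smul_top_le_comap (I : Ideal R) (n : ℕ) (g : N →ₗ[R] N') :
    I ^ n • ⊤ ≤ (I ^ n • (⊤ : Submodule R N')).comap g := by
  rw [← Submodule.map_le_iff_le_comap, Submodule.map_smul'']
  exact smul_mono_right _ le_top

lemma samuel_le_of_surjective (I : Ideal R) {g : N →ₗ[R] N'} (hg : Function.Surjective g)
    (n : ℕ) : samuel I N' n ≤ samuel I N n := by
  rw [samuel, ← LinearMap.range_eq_top.2 hg, ← Submodule.map_top, ← relLen_comap, Submodule.map_top,
    LinearMap.range_eq_top.2 hg]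
  exact relLen_anti_left _ (pow_smul_top_le_comap I n g)

variable [IsNoetherianRing R]

lemma exists_comap_pow_smul_le [Module.Finite R N'] (I : Ideal R) {f : N →ₗ[R] N'}
    (hf : Function.Injective f) :
    ∃ c, ∀ n, (I ^ (n + c) • (⊤ : Submodule R N')).comap f ≤ I ^ n • ⊤ := by
  obtain ⟨c, hc⟩ := I.exists_pow_inf_eq_pow_smul (LinearMap.range f)
  refine ⟨c, fun n x hx => ?_⟩
  have hfx : f x ∈ I ^ (n + c) • ⊤ ⊓ LinearMap.range f := ⟨hx, x, rfl⟩
  rw [hc _ (Nat.le_add_left c n), Nat.add_sub_cancel] at hfx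
  rw [← Submodule.comap_map_eq_of_injective hf (I ^ n • ⊤), Submodule.map_smul'',
    Submodule.map_top]
  exact (smul_mono_right (I ^ n) inf_le_right : _ ≤ I ^ n • LinearMap.range f) hfx

lemma exists_samuel_le_of_injective [Module.Finite R N'] (I : Ideal R) {f : N →ₗ[R] N'}
    (hf : Function.Injective f) : ∃ c, ∀ n,
      samuel I N n ≤ relLen (I ^ (n + c) • (⊤ : Submodule R N')) (LinearMap.range f) := by
  obtain ⟨c, hc⟩ := exists_comap_pow_smul_le I hf
  refine ⟨c, fun n => ?_⟩
  rw [← Submodule.map_top, ← relLen_comap]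
  exact relLen_anti_left _ (hc n)

lemma exists_samuel_add_le [Module.Finite R N'] (I : Ideal R) {f : N →ₗ[R] N'}
    (hf : Function.Injective f) {g : N' →ₗ[R] N''} (hg : Function.Surjective g)
    (hgf : g ∘ₗ f = 0) :
    ∃ c, ∀ n, samuel I N n + samuel I N'' (n + c) ≤ samuel I N' (n + c) := by
  obtain ⟨c, hc⟩ := exists_samuel_le_of_injective I hf
  refine ⟨c, fun n => ?_⟩
  rw [samuel.eq_def I N' (n + c), relLen_eq_add_of_le ⊤ (pow_smul_top_le_comap I (n + c) g),
    inf_top_eq, relLen_comap, Submodule.map_top, LinearMap.range_eq_top.2 hg]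
  refine add_le_add_left ?_ _
  refine (hc n).trans (relLen_mono_right _ ?_)
  rintro _ ⟨x, rfl⟩
  rw [Submodule.mem_comap, ← LinearMap.comp_apply, hgf]
  exact zero_mem _

lemma exists_isHilbertPolynomial_samuel [Module.Finite R N] {I : Ideal R}
    (hfin : ∀ n, samuel I N n ≠ ⊤) : ∃ P : ℚ[X], IsHilbertPolynomial (samuel I N) P := by
  obtain ⟨s, rfl⟩ := IsNoetherian.noetherian I
  set J := Ideal.span (s : Set R)
  have hstable : IsStableSubquotient J (fun n => J ^ (n + 1) • (⊤ : Submodule R N))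
      fun n => J ^ n • ⊤ :=
    { antitone_lower := fun _ _ hmn => antitone_pow_smul J ⊤ (Nat.succ_le_succ hmn)
      smul_lower_le := fun n => (smul_pow_smul_eq J (n + 1) ⊤).le
      smul_upper_le := fun n => (smul_pow_smul_eq J n ⊤).le
      eventually_upper_le := Eventually.of_forall fun n =>
        (smul_pow_smul_eq J n ⊤).ge.trans le_sup_left }
  obtain ⟨B, hB_deg, hB⟩ := hstable.exists_isHilbertPolynomial fun n =>
    ne_top_of_le_ne_top (hfin (n + 1)) (samuel_succ (N := N) J n ▸ le_add_self)
  obtain ⟨P, -, hP⟩ := IsHilbertPolynomial.exists_of_add_eq (IsHilbertPolynomial.const 0)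
    (by simp) hB hB_deg hfin fun n => by
      rw [samuel_succ, Nat.cast_zero, add_zero]
  exact ⟨P, hP⟩

variable [IsLocalRing R] {I : Ideal R} (hI : I ≤ IsLocalRing.maximalIdeal R)
include hI

omit [IsNoetherianRing R] in
lemma not_polyBounded_zero_samuel [Module.Finite R N] [Nontrivial N] :
    ¬PolyBounded 0 (samuel I N) := fun h => by
  obtain ⟨n, hn, hn₁⟩ := (h.eventually_eq_zero.and (eventually_ge_atTop 1)).exists
  have hbot : (⊤ : Submodule R N) = ⊥ :=
    Submodule.eq_bot_of_le_smul_of_le_jacobson_bot (I ^ n) ⊤ Module.Finite.fg_top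
      (relLen_eq_zero.1 hn) <| by
        rw [IsLocalRing.jacobson_eq_maximalIdeal _ bot_ne_top]
        exact (Ideal.pow_le_self (by lia)).trans hI
  exact top_ne_bot hbot

omit hI [IsLocalRing R] in
/-- For `x ∈ q ∖ p`, multiplication by `x` is injective on `R ⧸ p` and zero on `R ⧸ q`. -/
lemma polyBounded_samuel_quotient_of_lt {p q : PrimeSpectrum R} (hpq : p < q) {d : ℕ}
    (h : PolyBounded (d + 1) (samuel I (R ⧸ p.asIdeal))) :
    PolyBounded d (samuel I (R ⧸ q.asIdeal)) := by
  obtain ⟨x, hxq, hxp⟩ : ∃ x ∈ q.asIdeal, x ∉ p.asIdeal :=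
    SetLike.not_le_iff_exists.1 hpq.not_ge
  have hinj : Function.Injective (LinearMap.lsmul R (R ⧸ p.asIdeal) x) := by
    rw [← LinearMap.ker_eq_bot, LinearMap.ker_eq_bot']
    intro y hy
    rw [LinearMap.lsmul_apply, Algebra.smul_def, mul_eq_zero] at hy
    exact hy.resolve_left fun hx => hxp (Ideal.Quotient.eq_zero_iff_mem.1 hx)
  let π : (R ⧸ p.asIdeal) →ₗ[R] R ⧸ q.asIdeal := (Ideal.Quotient.factorₐ R hpq.le).toLinearMap
  have hzero : π ∘ₗ LinearMap.lsmul R (R ⧸ p.asIdeal) x = 0 := by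
    ext
    simpa [π, Algebra.smul_def] using Ideal.Quotient.eq_zero_iff_mem.2 hxq
  obtain ⟨c, hc⟩ := exists_samuel_add_le I hinj
    (g := π) (Ideal.Quotient.factor_surjective hpq.le) hzero
  obtain ⟨P, hP⟩ := exists_isHilbertPolynomial_samuel (h.ne_top (samuel_mono I))
  exact (hP.polyBounded_of_add_le (h.degree_lt hP) hc).mono
    (Eventually.of_forall fun n => samuel_mono I (Nat.le_add_right n c))

lemma coheight_lt_of_polyBounded_samuel {d : ℕ} {p : PrimeSpectrum R}
    (h : PolyBounded d (samuel I (R ⧸ p.asIdeal))) : Order.coheight p < d := by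
  induction d generalizing p with
  | zero => exact absurd h (not_polyBounded_zero_samuel hI)
  | succ d ih =>
    rw [Nat.cast_succ, ENat.lt_natCast_add_one_iff, Order.coheight_le_coe_iff]
    exact fun q hpq => ih (polyBounded_samuel_quotient_of_lt hpq h)

lemma supportDim_le_of_polyBounded_samuel [Module.Finite R N] {d : ℕ}
    (h : PolyBounded (d + 1) (samuel I N)) : Module.supportDim R N ≤ d := by
  refine iSup_le fun s => ?_
  obtain ⟨p, hp, hp_le⟩ := Ideal.exists_minimalPrimes_le
    (Module.mem_support_iff_of_finite.1 s.head.2)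
  have hass := Module.associatedPrimes.minimalPrimes_annihilator_subset_associatedPrimes R N hp
  obtain ⟨-, f, hf⟩ := (isAssociatedPrime_iff_exists_injective_linearMap _ _).1 hass
  obtain ⟨c, hc⟩ := exists_samuel_le_of_injective I hf
  have hhead : PolyBounded (d + 1) (samuel I (R ⧸ s.head.1.asIdeal)) :=
    (h.comp_add c).mono <| Eventually.of_forall fun n => calc
      samuel I (R ⧸ s.head.1.asIdeal) n ≤ samuel I (R ⧸ p) n := samuel_le_of_surjective I
        (g := (Ideal.Quotient.factorₐ R hp_le).toLinearMap) (Ideal.Quotient.factor_surjective hp_le)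
        n
      _ ≤ samuel I N (n + c) := (hc n).trans (relLen_mono_right _ le_top)
  have hlt := (Order.length_le_coheight_head (p := s.map Subtype.val fun _ _ h => h)).trans_lt
    (coheight_lt_of_polyBounded_samuel hI hhead)
  exact_mod_cast Nat.lt_succ_iff.1 (ENat.natCast_lt_natCast.1 hlt)

end HilbertSamuel

section Residual

variable {R : Type*} [CommRing R] {N : Type*} [AddCommGroup N] [Module R N]

/-- The residual submodule `(L : J) = {x | J x ⊆ L}`; thus `(L : J) / L` is the part of `N / L`
killed by `J`. -/
def residual (J : Ideal R) (L : Submodule R N) : Submodule R N where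
  carrier := {x | ∀ a ∈ J, a • x ∈ L}
  add_mem' hx hy a ha := by rw [smul_add]; exact L.add_mem (hx a ha) (hy a ha)
  zero_mem' a _ := by rw [smul_zero]; exact L.zero_mem
  smul_mem' r x hx a ha := by rw [smul_comm]; exact L.smul_mem r (hx a ha)

lemma le_residual (J : Ideal R) (L : Submodule R N) : L ≤ residual J L :=
  fun _ hx a _ => L.smul_mem a hx

lemma residual_mono (J : Ideal R) {L L' : Submodule R N} (h : L ≤ L') :
    residual J L ≤ residual J L' := fun _ hx a ha => h (hx a ha)

lemma le_residual_iff {J : Ideal R} {L U : Submodule R N} : U ≤ residual J L ↔ J • U ≤ L := by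
  rw [Submodule.smul_le]
  exact ⟨fun h a ha x hx => h hx a ha, fun h x hx a ha => h a ha x hx⟩

lemma smul_residual_self_le (J : Ideal R) (L : Submodule R N) : J • residual J L ≤ L :=
  le_residual_iff.1 le_rfl

lemma mem_residual_span {s : Set R} {L : Submodule R N} {x : N} :
    x ∈ residual (Ideal.span s) L ↔ ∀ a ∈ s, a • x ∈ L := by
  refine ⟨fun h a ha => h a (Ideal.subset_span ha), fun h a ha => ?_⟩
  have hle : Ideal.span s ≤ L.comap (LinearMap.toSpanSingleton R N x) := Ideal.span_le.2 h
  exact hle ha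

lemma residual_span_eq_inf (t : Finset R) (L : Submodule R N) :
    residual (Ideal.span (t : Set R)) L = t.inf fun a => L.comap (LinearMap.lsmul R N a) := by
  ext x
  simp [mem_residual_span, Submodule.mem_finsetInf]

lemma smul_residual_le (I J : Ideal R) (L : Submodule R N) :
    I • residual J L ≤ residual J (I • L) := by
  rw [le_residual_iff, ← mul_smul, mul_comm, mul_smul]
  exact smul_mono_right I (smul_residual_self_le J L)

lemma relLen_sup_le (L A B : Submodule R N) :
    relLen L (A ⊔ B) ≤ relLen L A + relLen L B := by
  rw [← relLen_sup_left L (A ⊔ B), ← sup_assoc,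
    relLen_add (le_sup_left : L ≤ L ⊔ A) le_sup_left, relLen_sup_left, relLen_sup_left]
  exact add_le_add_right (relLen_anti_left B le_sup_left) _

lemma relLen_inf_le (A B U : Submodule R N) :
    relLen (A ⊓ B) U ≤ relLen A U + relLen B U := by
  rw [relLen_eq_add_of_le U (inf_le_left : A ⊓ B ≤ A), add_comm]
  refine add_le_add_right ?_ _
  calc relLen (A ⊓ B) (A ⊓ U) = relLen (B ⊓ (A ⊓ U)) (A ⊓ U) := by
        rw [← relLen_inf_left (A ⊓ B), inf_inf_inf_comm, inf_idem, inf_left_comm]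
    _ = relLen B (A ⊓ U) := relLen_inf_left _ _
    _ ≤ relLen B U := relLen_mono_right _ inf_le_right

lemma relLen_finset_inf_le {ι : Type*} (s : Finset ι) (A : ι → Submodule R N)
    (U : Submodule R N) : relLen (s.inf A) U ≤ ∑ i ∈ s, relLen (A i) U := by
  classical
  induction s using Finset.induction_on with
  | empty => simp [relLen_eq_zero.2 le_top]
  | insert i s hi ih =>
    rw [Finset.inf_insert, Finset.sum_insert hi]
    exact (relLen_inf_le _ _ _).trans (add_le_add_right ih _)

lemma relLen_span_singleton_le_one {m : Ideal R} (hm : m.IsMaximal) {L : Submodule R N} {x : N}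
    (hx : x ∈ residual m L) : relLen L (Submodule.span R {x}) ≤ 1 := by
  have : IsSimpleModule R (R ⧸ m) := isSimpleModule_iff_isCoatom.2 hm.out
  have htop : relLen (m : Submodule R R) ⊤ = 1 := by
    rw [relLen, Submodule.map_top, Submodule.range_mkQ, Module.length_top]
    exact Module.length_eq_one R (R ⧸ m)
  rw [← LinearMap.range_toSpanSingleton, ← Submodule.map_top, ← relLen_comap, ← htop]
  exact relLen_anti_left _ fun a ha => hx a ha

lemma relLen_ne_top_of_le_residual [IsNoetherian R N] {m : Ideal R} (hm : m.IsMaximal)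
    {L U : Submodule R N} (h : U ≤ residual m L) : relLen L U ≠ ⊤ := by
  have hfg : U.FG := IsNoetherian.noetherian U
  induction U, hfg using Submodule.fg_induction with
  | singleton x =>
    exact ne_top_of_le_ne_top ENat.one_ne_top
      (relLen_span_singleton_le_one hm (h (Submodule.mem_span_singleton_self x)))
  | sup A B _ _ hA hB =>
    refine ne_top_of_le_ne_top ?_ (relLen_sup_le L A B)
    exact WithTop.add_ne_top.2 ⟨hA (le_sup_left.trans h), hB (le_sup_right.trans h)⟩

lemma relLen_residual_le_card_mul {t : Finset R} {L U : Submodule R N} {k : ℕ∞}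
    (h : ∀ a ∈ t, relLen L (U.map (LinearMap.lsmul R N a)) ≤ k) :
    relLen (residual (Ideal.span (t : Set R)) L) U ≤ t.card * k := by
  rw [residual_span_eq_inf, ← nsmul_eq_mul]
  refine (relLen_finset_inf_le t _ U).trans (Finset.sum_le_card_nsmul _ _ _ fun a ha => ?_)
  rw [relLen_comap]
  exact h a ha

lemma map_lsmul_residual_pow_succ_le {J : Ideal R} {a : R} (ha : a ∈ J) (s : ℕ)
    (L : Submodule R N) :
    (residual (J ^ (s + 1)) L).map (LinearMap.lsmul R N a) ≤ residual (J ^ s) L := by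
  rintro _ ⟨x, hx, rfl⟩ b hb
  rw [LinearMap.lsmul_apply, smul_smul]
  exact hx _ (Ideal.mul_mem_mul hb ha)

lemma exists_relLen_residual_pow_le {J : Ideal R} (hJ : J.FG) (s : ℕ) :
    ∃ C : ℕ, ∀ L : Submodule R N,
      relLen L (residual (J ^ s) L) ≤ C * relLen L (residual J L) := by
  obtain ⟨t, rfl⟩ := hJ
  set J := Ideal.span (t : Set R)
  induction s with
  | zero =>
    refine ⟨0, fun L => ?_⟩
    rw [Nat.cast_zero, zero_mul, nonpos_iff_eq_zero, relLen_eq_zero]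
    intro x hx
    simpa using hx 1 (by simp)
  | succ s ih =>
    obtain ⟨C, hC⟩ := ih
    refine ⟨1 + t.card * C, fun L => ?_⟩
    calc relLen L (residual (J ^ (s + 1)) L)
        ≤ relLen L (residual J L) + relLen (residual J L) (residual (J ^ (s + 1)) L) :=
          relLen_le_add _ _ _
      _ ≤ relLen L (residual J L) + t.card * (C * relLen L (residual J L)) :=
          add_le_add_right (relLen_residual_le_card_mul fun a ha => (relLen_mono_right _
            (map_lsmul_residual_pow_succ_le (Ideal.subset_span ha) s L)).trans (hC L)) _
      _ = (1 + t.card * C : ℕ) * relLen L (residual J L) := by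
          push_cast
          ring

end Residual

section ResidualFiltration

open Filter

variable {R : Type*} [CommRing R] {N : Type*} [AddCommGroup N] [Module R N]

lemma mem_smul_pi {ι : Type*} [Finite ι] (J : Ideal R) (W : Submodule R N) {v : ι → N}
    (hv : ∀ i, v i ∈ J • W) : v ∈ J • Submodule.pi Set.univ fun _ : ι => W := by
  classical
  have := Fintype.ofFinite ι
  rw [← Finset.univ_sum_single v]
  refine Submodule.sum_mem _ fun i _ => ?_
  have hsingle : (J • W).map (LinearMap.single R (fun _ : ι => N) i) ≤
      J • Submodule.pi Set.univ fun _ : ι => W := by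
    rw [Submodule.map_smul'']
    exact smul_mono_right J
      (Submodule.map_le_iff_le_comap.2 fun x hx => Submodule.le_comap_single_pi _ hx)
  exact hsingle ⟨v i, hv i, rfl⟩

lemma residual_span_range_eq_comap {ι : Type*} (a : ι → R) (L : Submodule R N) :
    residual (Ideal.span (Set.range a)) L =
      (Submodule.pi Set.univ fun _ => L).comap
        (LinearMap.pi fun i => LinearMap.lsmul R N (a i)) := by
  ext x
  simp [mem_residual_span, Submodule.mem_pi]

variable [IsNoetherianRing R] [Module.Finite R N]

/-- Artin–Rees, applied to the embedding of `N / (0 : m)` into a power of `N` given by generators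
of `m`. -/
lemma eventually_residual_le {J : Ideal R} {F : J.Filtration N} (hF : F.Stable) (m : Ideal R) :
    ∀ᶠ n in atTop, residual m (F.N (n + 1)) ≤ J • residual m (F.N n) ⊔ residual m ⊥ := by
  obtain ⟨r, a, ha⟩ := Submodule.fg_iff_exists_fin_generating_family.1 (IsNoetherian.noetherian m)
  replace ha : Ideal.span (Set.range a) = m := ha
  obtain ⟨c, hc⟩ := hF.exists_pow_smul_eq
  let φ : N →ₗ[R] Fin r → N := LinearMap.pi fun i => LinearMap.lsmul R N (a i)
  have hker : LinearMap.ker φ = residual m ⊥ := by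
    rw [← ha, residual_span_range_eq_comap, Submodule.pi_univ_bot, LinearMap.ker]
  have hmap : ∀ᶠ n in atTop, J • (residual m (F.N (c + n))).map φ =
      (residual m (F.N (c + (n + 1)))).map φ := by
    refine eventually_smul_eq_of_le (W := Submodule.pi Set.univ fun _ => F.N c)
      (fun i j hij => Submodule.map_mono (residual_mono _ (F.antitone (by lia)))) (fun n => ?_)
      fun n => ?_
    · rw [← Submodule.map_smul'']
      exact Submodule.map_mono ((smul_residual_le _ _ _).trans (residual_mono _ (F.smul_le _)))
    · rw [Submodule.map_le_iff_le_comap]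
      exact fun x hx => mem_smul_pi _ _ fun i =>
        hc n ▸ hx _ (ha ▸ Ideal.subset_span (Set.mem_range_self i))
  obtain ⟨d, hd⟩ := eventually_atTop.1 hmap
  refine eventually_atTop.2 ⟨c + d, fun n hn => ?_⟩
  obtain ⟨k, rfl⟩ := Nat.exists_eq_add_of_le ((Nat.le_add_right c d).trans hn)
  have hk := hd k (by lia)
  rw [← Submodule.map_smul''] at hk
  rw [← hker, ← Submodule.comap_map_eq, hk]
  exact Submodule.le_comap_map _ _

lemma eventually_relLen_eq_of_smul_eq_bot {I : Ideal R} {K : Submodule R N} (hK : I • K = ⊥) :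
    ∀ᶠ n in atTop, relLen (I ^ n • (⊤ : Submodule R N)) K = relLen ⊥ K := by
  obtain ⟨c, hc⟩ := I.exists_pow_inf_eq_pow_smul K
  refine eventually_atTop.2 ⟨c + 1, fun n hn => ?_⟩
  have hbot : I ^ n • ⊤ ⊓ K = ⊥ := by
    rw [hc n (by lia), eq_bot_iff, ← hK]
    exact Submodule.smul_mono (Ideal.pow_le_self (by lia)) inf_le_right
  rw [← relLen_inf_left, hbot]

end ResidualFiltration

section Reduction

open Filter

variable {R : Type*} [CommRing R] {N : Type*} [AddCommGroup N] [Module R N] {I K : Ideal R}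

/-- The ideal `K` is a reduction of the ideal `I` with respect to the module `N`. -/
structure IsReduction (K I : Ideal R) (N : Type*) [AddCommGroup N] [Module R N] : Prop where
  le : K ≤ I
  exists_pow_smul_le : ∃ n, I ^ (n + 1) • (⊤ : Submodule R N) ≤ K • I ^ n • ⊤

namespace IsReduction

lemma refl (I : Ideal R) : IsReduction I I N :=
  ⟨le_rfl, 0, (smul_pow_smul_eq I 0 ⊤).ge⟩

lemma of_pow_smul_le {e n : ℕ} (he : e ≠ 0) (hK : K ≤ I ^ e)
    (h : I ^ (n + e) • (⊤ : Submodule R N) ≤ K • I ^ n • ⊤) : IsReduction K (I ^ e) N := by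
  obtain ⟨k, hk⟩ := Nat.exists_eq_add_of_le' (Nat.le_mul_of_pos_left n (Nat.pos_of_ne_zero he))
  refine ⟨hK, n, ?_⟩
  rw [← pow_mul, ← pow_mul, mul_add, mul_one, hk, add_assoc, pow_add, mul_smul, pow_add I k n,
    mul_smul, ← mul_smul K, mul_comm K, mul_smul]
  exact smul_mono_right _ h

lemma isStable (h : IsReduction K I N) : ∃ F : K.Filtration N,
    F.Stable ∧ ∀ n, F.N n = I ^ n • ⊤ := by
  let F : K.Filtration N := ⟨fun n => I ^ n • ⊤, fun n => antitone_pow_smul I ⊤ n.le_succ,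
    fun n => (Submodule.smul_mono_left h.le).trans (smul_pow_smul_eq I n ⊤).le⟩
  obtain ⟨c, hc⟩ := h.exists_pow_smul_le
  refine ⟨F, ⟨c, fun n hn => (F.smul_le n).antisymm ?_⟩, fun _ => rfl⟩
  obtain ⟨k, rfl⟩ := Nat.exists_eq_add_of_le' hn
  change I ^ (k + c + 1) • ⊤ ≤ K • I ^ (k + c) • ⊤
  rw [add_assoc, pow_add, mul_smul, pow_add I k c, mul_smul, ← mul_smul K, mul_comm K, mul_smul]
  exact smul_mono_right _ hc

end IsReduction

end Reduction

section SoclePolynomial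

open Polynomial Filter

variable {R : Type*} [CommRing R] {N : Type*} [AddCommGroup N] [Module R N] [IsLocalRing R]

/-- The length of the socle of `N / L` over a local ring. -/
noncomputable def socleLen (L : Submodule R N) : ℕ∞ :=
  relLen L (residual (IsLocalRing.maximalIdeal R) L)

variable {I K : Ideal R}

local notation "𝔪" => IsLocalRing.maximalIdeal R

lemma socleLen_ne_top [IsNoetherian R N] (L : Submodule R N) : socleLen L ≠ ⊤ :=
  relLen_ne_top_of_le_residual (IsLocalRing.maximalIdeal.isMaximal R) le_rfl

/-- Splits the socle of `N / L` along the image of the socle of `N`, which is eventually constant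
in the applications. -/
lemma socleLen_eq_add (L : Submodule R N) :
    socleLen L = relLen L (residual 𝔪 ⊥) + relLen (residual 𝔪 ⊥ ⊔ L) (residual 𝔪 L) := by
  rw [socleLen, relLen_add (le_sup_right : L ≤ residual 𝔪 ⊥ ⊔ L)
    (sup_le (residual_mono _ bot_le) (le_residual _ _)), sup_comm, relLen_sup_left]

variable [IsNoetherianRing R] [Module.Finite R N]

lemma isStableSubquotient_residual {F : K.Filtration N} (hF : F.Stable) :
    IsStableSubquotient K (fun n => residual 𝔪 ⊥ ⊔ F.N n) fun n => residual 𝔪 (F.N n) where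
  antitone_lower _ _ hmn := sup_le_sup_left (F.antitone hmn) _
  smul_lower_le n := by
    rw [Submodule.smul_sup]
    exact sup_le_sup Submodule.smul_le_right (F.smul_le n)
  smul_upper_le n := (smul_residual_le _ _ _).trans (residual_mono _ (F.smul_le n))
  eventually_upper_le :=
    (eventually_residual_le hF _).mono fun _ hn => hn.trans (sup_le_sup_left le_sup_left _)

lemma exists_isHilbertPolynomial_socleLen (hI : I ≤ 𝔪) {s : Finset R}
    (hs : IsReduction (Ideal.span (s : Set R)) I N) :
    ∃ P : ℚ[X], P.degree < (max s.card 1 : ℕ) ∧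
      IsHilbertPolynomial (fun n => socleLen (I ^ n • (⊤ : Submodule R N))) P := by
  obtain ⟨F, hF, hF_eq⟩ := hs.isStable
  have hmax : (𝔪).IsMaximal := IsLocalRing.maximalIdeal.isMaximal R
  obtain ⟨P, hP_deg, hP⟩ := (isStableSubquotient_residual hF).exists_isHilbertPolynomial fun n =>
    ne_top_of_le_ne_top (relLen_ne_top_of_le_residual hmax le_rfl)
      (relLen_anti_left _ le_sup_right)
  have hconst := eventually_relLen_eq_of_smul_eq_bot (I := I) (K := residual 𝔪 (⊥ : Submodule R N))
    (eq_bot_iff.2 ((Submodule.smul_mono_left hI).trans (smul_residual_self_le _ _)))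
  lift relLen ⊥ (residual 𝔪 (⊥ : Submodule R N)) to ℕ using
    relLen_ne_top_of_le_residual hmax le_rfl with k
  refine ⟨C (k : ℚ) + P, ?_, ((IsHilbertPolynomial.const k).add hP).congr ?_⟩
  · refine (degree_add_le _ _).trans_lt (max_lt (degree_C_lt.trans_le ?_) (hP_deg.trans_le ?_))
    · exact_mod_cast le_max_right s.card 1
    · exact_mod_cast le_max_left s.card 1
  · filter_upwards [hconst] with n hn
    rw [socleLen_eq_add, hn, hF_eq]

lemma degree_lt_of_isReduction (hI : I ≤ 𝔪) {P : ℚ[X]}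
    (hP : IsHilbertPolynomial (fun n => socleLen (I ^ n • (⊤ : Submodule R N))) P) {e : ℕ}
    (he : e ≠ 0) {s : Finset R} (hs : IsReduction (Ideal.span (s : Set R)) (I ^ e) N) :
    P.degree < (max s.card 1 : ℕ) := by
  obtain ⟨Q, hQ, hQs⟩ := exists_isHilbertPolynomial_socleLen ((Ideal.pow_le_self he).trans hI) hs
  simp only [← pow_mul] at hQs
  exact (hQs.polyBounded hQ).degree_lt_of_comp_mul he hP

lemma supportDim_le_of_polyBounded_socleLen (hI : I ≤ 𝔪) {s : ℕ}
    (hs : 𝔪 ^ s • (⊤ : Submodule R N) ≤ I • ⊤) {d : ℕ}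
    (h : PolyBounded d fun n => socleLen (I ^ n • (⊤ : Submodule R N))) :
    Module.supportDim R N ≤ d := by
  obtain ⟨C, hC⟩ := exists_relLen_residual_pow_le (N := N) (IsNoetherian.noetherian 𝔪) s
  have hle : ∀ n, relLen (I ^ (n + 1) • (⊤ : Submodule R N)) (I ^ n • ⊤) ≤
      C * socleLen (I ^ (n + 1) • (⊤ : Submodule R N)) := fun n => by
    refine (relLen_mono_right _ ?_).trans (hC _)
    rw [le_residual_iff, ← mul_smul, mul_comm, mul_smul, pow_succ, mul_smul]
    exact smul_mono_right _ hs
  have hfin : ∀ n, samuel I N n ≠ ⊤ := fun n => by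
    induction n with
    | zero => rw [samuel_zero]; exact ENat.zero_ne_top
    | succ n ih =>
      rw [samuel_succ]
      refine WithTop.add_ne_top.2 ⟨ih, ne_top_of_le_ne_top ?_ (hle n)⟩
      exact WithTop.mul_ne_top (ENat.natCast_ne_top _) (socleLen_ne_top _)
  refine supportDim_le_of_polyBounded_samuel hI
    (((h.comp_add 1).const_mul C).of_le_add hfin fun n => ?_)
  rw [samuel_succ]
  exact add_le_add_right (hle n) _

end SoclePolynomial

section LocalSocle

variable {R : Type*} [CommRing R] {N : Type*} [AddCommGroup N] [Module R N]

lemma relLen_pi_top (ι : Type*) [Fintype ι] {m : Ideal R} (hm : m.IsMaximal) :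
    relLen (Submodule.pi Set.univ fun _ : ι => (m : Submodule R R)) ⊤ = Fintype.card ι := by
  classical
  have : IsSimpleModule R (R ⧸ m) := isSimpleModule_iff_isCoatom.2 hm.out
  rw [relLen, Submodule.map_top, Submodule.range_mkQ, Module.length_top,
    (Submodule.quotientPi fun _ : ι => (m : Submodule R R)).length_eq,
    Module.length_pi_of_fintype]
  simp only [Module.length_eq_one, Finset.sum_const, Finset.card_univ, nsmul_one]

variable [IsLocalRing R]

local notation "𝔪" => IsLocalRing.maximalIdeal R

lemma card_le_socleLen {ι : Type*} [Fintype ι] {L : Submodule R N} (x : ι → N)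
    (hx : ∀ i, x i ∈ residual 𝔪 L)
    (hind : ∀ c : ι → R, ∑ i, c i • x i ∈ L → ∀ i, c i ∈ 𝔪) :
    (Fintype.card ι : ℕ∞) ≤ socleLen L := by
  rw [← relLen_pi_top ι (IsLocalRing.maximalIdeal.isMaximal R)]
  calc relLen (Submodule.pi Set.univ fun _ : ι => (𝔪 : Submodule R R)) ⊤
      ≤ relLen (L.comap (Fintype.linearCombination R x)) ⊤ := by
        refine relLen_anti_left _ fun c hc i _ => hind c ?_ i
        rwa [Submodule.mem_comap, Fintype.linearCombination_apply] at hc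
    _ = relLen L (Submodule.span R (Set.range x)) := by
        rw [relLen_comap, Submodule.map_top, Fintype.range_linearCombination]
    _ ≤ socleLen L := relLen_mono_right _ (Submodule.span_le.2 (Set.range_subset_iff.2 hx))

lemma socleLen_inf_le (L L' : Submodule R N) : socleLen (L ⊓ L') ≤ socleLen L + socleLen L' :=
  (relLen_inf_le _ _ _).trans (add_le_add (relLen_mono_right _ (residual_mono _ inf_le_left))
    (relLen_mono_right _ (residual_mono _ inf_le_right)))

lemma socleLen_top : socleLen (⊤ : Submodule R N) = 0 := relLen_eq_zero.2 le_top

omit [IsLocalRing R] in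
lemma exists_smul_sub_smul_mem {Q : Submodule R N} (hQ : InfIrred Q) {x y : N} (hx : x ∉ Q)
    (hy : y ∉ Q) : ∃ a b : R, a • x ∉ Q ∧ a • x - b • y ∈ Q := by
  by_contra! h
  have hinf : (Q ⊔ Submodule.span R {x}) ⊓ (Q ⊔ Submodule.span R {y}) = Q := by
    refine le_antisymm ?_ (le_inf le_sup_left le_sup_left)
    rintro z ⟨hzx, hzy⟩
    obtain ⟨q, hq, _, ha, rfl⟩ := Submodule.mem_sup.1 hzx
    obtain ⟨q', hq', _, hb, hz⟩ := Submodule.mem_sup.1 hzy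
    obtain ⟨a, rfl⟩ := Submodule.mem_span_singleton.1 ha
    obtain ⟨b, rfl⟩ := Submodule.mem_span_singleton.1 hb
    by_contra hzQ
    refine h a b (fun hax => hzQ (Q.add_mem hq hax)) ?_
    have hdiff : a • x - b • y = q' - q := by
      rw [sub_eq_sub_iff_add_eq_add, add_comm, ← hz]
    exact hdiff ▸ Q.sub_mem hq' hq
  rcases hQ.2 hinf with h | h
  · exact hx (h ▸ Submodule.mem_sup_right (Submodule.mem_span_singleton_self x))
  · exact hy (h ▸ Submodule.mem_sup_right (Submodule.mem_span_singleton_self y))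

lemma socleLen_le_one_of_infIrred {Q : Submodule R N} (hQ : InfIrred Q) : socleLen Q ≤ 1 := by
  by_cases hle : residual 𝔪 Q ≤ Q
  · exact (relLen_eq_zero.2 hle).trans_le zero_le_one
  obtain ⟨y, hy, hyQ⟩ := SetLike.not_le_iff_exists.1 hle
  have hspan : residual 𝔪 Q ≤ Q ⊔ Submodule.span R {y} := by
    intro x hx
    by_cases hxQ : x ∈ Q
    · exact Submodule.mem_sup_left hxQ
    obtain ⟨a, b, ha, hab⟩ := exists_smul_sub_smul_mem hQ hxQ hyQ
    have hunit : IsUnit a := by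
      by_contra h
      exact ha (hx a h)
    refine (Submodule.smul_mem_iff_of_isUnit _ hunit).1 (sub_add_cancel (a • x) (b • y) ▸ ?_)
    exact Submodule.add_mem_sup hab (Submodule.smul_mem _ b (Submodule.mem_span_singleton_self y))
  calc socleLen Q ≤ relLen Q (Q ⊔ Submodule.span R {y}) := relLen_mono_right _ hspan
    _ = relLen Q (Submodule.span R {y}) := relLen_sup_left _ _
    _ ≤ 1 := relLen_span_singleton_le_one (IsLocalRing.maximalIdeal.isMaximal R) hy

end LocalSocle

section LocalizedSubmodule

variable {R : Type*} [CommRing R] {M : Type*} [AddCommGroup M] [Module R M] {S : Submonoid R}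

lemma mkLinearMap_mem_localized {N : Submodule R M} {x : M} :
    LocalizedModule.mkLinearMap S M x ∈ N.localized S ↔ ∃ s : S, s • x ∈ N := by
  rw [Submodule.mem_localized']
  constructor
  · rintro ⟨y, hy, s, h⟩
    rw [IsLocalizedModule.mk'_eq_iff, ← LinearMap.map_smul_of_tower,
      IsLocalizedModule.eq_iff_exists S] at h
    obtain ⟨c, hc⟩ := h
    refine ⟨c * s, ?_⟩
    rw [mul_smul, ← hc]
    exact N.smul_of_tower_mem c hy
  · rintro ⟨s, hs⟩
    exact ⟨_, hs, s, by rw [IsLocalizedModule.mk'_eq_iff, LinearMap.map_smul_of_tower]⟩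

lemma exists_sum_smul_mem_of_sum_smul_mem_localized {ι : Type*} [Fintype ι] {N : Submodule R M}
    {x : ι → M} {c : ι → Localization S}
    (hc : ∑ i, c i • LocalizedModule.mkLinearMap S M (x i) ∈ N.localized S) :
    ∃ (s : S) (r : ι → R), (∀ i, algebraMap R (Localization S) (r i) = (s : R) • c i) ∧
      ∑ i, r i • x i ∈ N := by
  obtain ⟨b, hb⟩ := IsLocalization.exist_integer_multiples_of_finite S c
  choose r hr using hb
  have hmem : LocalizedModule.mkLinearMap S M (∑ i, r i • x i) ∈ N.localized S := by
    have hsum : LocalizedModule.mkLinearMap S M (∑ i, r i • x i) =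
        (b : R) • ∑ i, c i • LocalizedModule.mkLinearMap S M (x i) := by
      rw [Finset.smul_sum, map_sum]
      refine Finset.sum_congr rfl fun i _ => ?_
      rw [map_smul, ← algebraMap_smul (Localization S) (r i), hr, smul_assoc]
    rw [hsum]
    exact Submodule.smul_of_tower_mem _ _ hc
  obtain ⟨t, ht⟩ := mkLinearMap_mem_localized.1 hmem
  refine ⟨t * b, fun i => t * r i, fun i => ?_, ?_⟩
  · rw [map_mul, hr, ← Algebra.smul_def, ← mul_smul, Submonoid.coe_mul]
  · simpa only [mul_smul, ← Finset.smul_sum, ← Submonoid.smul_def] using ht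

lemma infIrred_localized {Q : Submodule R M} (hQ : InfIrred Q) (hne : Q.localized S ≠ ⊤)
    (hsat : ∀ (s : S) (x : M), s • x ∈ Q → x ∈ Q) : InfIrred (Q.localized S) := by
  let gi := Submodule.localized'gi (Localization S) S (LocalizedModule.mkLinearMap S M)
  refine ⟨fun hmax => hne hmax.eq_top, fun A B hAB => ?_⟩
  have hQeq : (A.restrictScalars R).comap (LocalizedModule.mkLinearMap S M) ⊓
      (B.restrictScalars R).comap (LocalizedModule.mkLinearMap S M) = Q := by
    ext x
    refine Iff.trans ?_ (mkLinearMap_mem_localized (S := S).trans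
      ⟨fun ⟨s, hs⟩ => hsat s x hs, fun hx => ⟨1, by rwa [one_smul]⟩⟩)
    rw [← hAB]
    rfl
  exact (hQ.2 hQeq).imp (fun h => (gi.l_u_eq A).symm.trans (congrArg _ h))
    fun h => (gi.l_u_eq B).symm.trans (congrArg _ h)

end LocalizedSubmodule

section PrimeSocle

variable {R : Type*} [CommRing R] {M : Type*} [AddCommGroup M] [Module R M] (p : PrimeSpectrum R)

/-- The length of the socle of `(M / N)_p` over `R_p`. -/
noncomputable def primeSocleLen (N : Submodule R M) : ℕ∞ :=
  socleLen (N.localized p.asIdeal.primeCompl)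

lemma primeSocleLen_top : primeSocleLen p (⊤ : Submodule R M) = 0 := by
  have h : (⊤ : Submodule R M).localized p.asIdeal.primeCompl = ⊤ := Submodule.localized'_top ..
  rw [primeSocleLen, h, socleLen_top]

lemma primeSocleLen_inf_le (Q Q' : Submodule R M) :
    primeSocleLen p (Q ⊓ Q') ≤ primeSocleLen p Q + primeSocleLen p Q' := by
  have h : (Q ⊓ Q').localized p.asIdeal.primeCompl =
    Q.localized p.asIdeal.primeCompl ⊓ Q'.localized p.asIdeal.primeCompl :=
      Submodule.localized'_inf ..
  rw [primeSocleLen, h]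
  exact socleLen_inf_le _ _

lemma primeSocleLen_finset_inf_le (s : Finset (Submodule R M)) :
    primeSocleLen p (s.inf id) ≤ ∑ Q ∈ s, primeSocleLen p Q := by
  classical
  induction s using Finset.induction_on with
  | empty => exact (primeSocleLen_top p).le
  | insert Q s hQ ih =>
    rw [Finset.inf_insert, Finset.sum_insert hQ]
    exact (primeSocleLen_inf_le p _ _).trans (add_le_add le_rfl ih)

variable {p} {N : Submodule R M}

lemma mkLinearMap_mem_residual_localized {x : M} :
    LocalizedModule.mkLinearMap p.asIdeal.primeCompl M x ∈
      residual (IsLocalRing.maximalIdeal (Localization.AtPrime p.asIdeal))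
        (N.localized p.asIdeal.primeCompl) ↔
    ∀ r ∈ p.asIdeal, ∃ s : p.asIdeal.primeCompl, s • r • x ∈ N := by
  rw [← Localization.AtPrime.map_eq_maximalIdeal, Ideal.map, mem_residual_span,
    Set.forall_mem_image]
  refine forall₂_congr fun r _ => ?_
  rw [algebraMap_smul, ← map_smul, mkLinearMap_mem_localized]

lemma card_le_primeSocleLen {ι : Type*} [Fintype ι] (x : ι → M)
    (hx : ∀ i, p.asIdeal ≤ N.colon {x i})
    (hind : ∀ c : ι → R, ∑ i, c i • x i ∈ N → ∀ i, c i ∈ p.asIdeal) :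
    (Fintype.card ι : ℕ∞) ≤ primeSocleLen p N := by
  refine card_le_socleLen (fun i => LocalizedModule.mkLinearMap p.asIdeal.primeCompl M (x i))
    (fun i => mkLinearMap_mem_residual_localized.2 fun r hr => ⟨1, ?_⟩) fun c hc i => ?_
  · rw [one_smul]
    exact Submodule.mem_colon_singleton.1 (hx i hr)
  · obtain ⟨s, r, hr, hsum⟩ := exists_sum_smul_mem_of_sum_smul_mem_localized hc
    have hri := (IsLocalization.AtPrime.to_map_mem_maximal_iff
      (Localization.AtPrime p.asIdeal) p.asIdeal (r i)).2 (hind r hsum i)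
    rw [hr, ← algebraMap_smul (Localization.AtPrime p.asIdeal)] at hri
    exact (Submodule.smul_mem_iff_of_isUnit _ (IsLocalization.map_units _ s)).1 hri

variable [IsNoetherianRing R]

lemma exists_colon_singleton_eq_of_primeSocleLen_ne_zero (h : primeSocleLen p N ≠ 0) :
    ∃ x : M, N.colon {x} = p.asIdeal := by
  rw [primeSocleLen, socleLen, Ne, relLen_eq_zero, SetLike.not_le_iff_exists] at h
  obtain ⟨z, hz, hzN⟩ := h
  obtain ⟨⟨x, s⟩, hxs⟩ := IsLocalizedModule.surj p.asIdeal.primeCompl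
    (LocalizedModule.mkLinearMap p.asIdeal.primeCompl M) z
  have hx : ∀ r ∈ p.asIdeal, ∃ t : p.asIdeal.primeCompl, t • r • x ∈ N :=
    mkLinearMap_mem_residual_localized.1 (hxs ▸ Submodule.smul_of_tower_mem _ _ hz)
  have hxN : ∀ t : p.asIdeal.primeCompl, t • x ∉ N := fun t ht => by
    have hmem := mkLinearMap_mem_localized.2 ⟨t, ht⟩
    rw [← hxs, Submonoid.smul_def, ← algebraMap_smul (Localization.AtPrime p.asIdeal)] at hmem
    exact hzN ((Submodule.smul_mem_iff_of_isUnit _ (IsLocalization.map_units _ s)).1 hmem)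
  obtain ⟨T, hT⟩ := IsNoetherian.noetherian p.asIdeal
  choose! t ht using hx
  let u : p.asIdeal.primeCompl := ∏ r ∈ T, t r
  refine ⟨u • x, le_antisymm (fun r hr => ?_) ?_⟩
  · by_contra hrp
    refine hxN (⟨r, hrp⟩ * u) ?_
    rw [mul_smul]
    exact Submodule.mem_colon_singleton.1 hr
  · refine hT.ge.trans (Submodule.span_le.2 fun r hr => ?_)
    rw [SetLike.mem_coe, Submodule.mem_colon_singleton]
    obtain ⟨w, hw⟩ : t r ∣ u := Finset.dvd_prod_of_mem t hr
    rw [hw, mul_comm, mul_smul, smul_comm r, smul_comm r]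
    exact N.smul_of_tower_mem w (ht r (hT.le (Submodule.subset_span hr)))

lemma mem_associatedPrimes_quotient {q : Ideal R} :
    q ∈ associatedPrimes R (M ⧸ N) ↔ q.IsPrime ∧ ∃ x, N.colon {x} = q := by
  have hcolon (x : M) : (⊥ : Submodule R (M ⧸ N)).colon {N.mkQ x} = N.colon {x} := by
    ext r
    rw [Submodule.mem_colon_singleton, Submodule.mem_colon_singleton, ← map_smul,
      Submodule.mem_bot, Submodule.mkQ_apply, Submodule.Quotient.mk_eq_zero]
  rw [AssociatedPrimes.mem_iff, isAssociatedPrime_iff, N.mkQ_surjective.exists]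
  simp only [hcolon, eq_comm]

lemma mem_associatedPrimes_of_primeSocleLen_ne_zero (h : primeSocleLen p N ≠ 0) :
    p.asIdeal ∈ associatedPrimes R (M ⧸ N) :=
  mem_associatedPrimes_quotient.2
    ⟨p.isPrime, exists_colon_singleton_eq_of_primeSocleLen_ne_zero h⟩

lemma exists_colon_singleton_isPrime {L : Submodule R M} (h : ¬ L ≤ N) :
    ∃ x ∈ L, (N.colon {x}).IsPrime := by
  obtain ⟨w, hwL, hwN⟩ := SetLike.not_le_iff_exists.1 h
  have hw : (⟨w, hwL⟩ : L) ∉ N.comap L.subtype := hwN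
  obtain ⟨P, hP, -⟩ := exists_le_isAssociatedPrime_of_isNoetherianRing R
    ((N.comap L.subtype).mkQ ⟨w, hwL⟩) (by simpa using hw)
  obtain ⟨hprime, x, rfl⟩ := mem_associatedPrimes_quotient.1 hP
  refine ⟨x, x.2, ?_⟩
  convert hprime using 1
  ext r
  simp only [Submodule.mem_colon_singleton, Submodule.mem_comap, map_smul, Submodule.subtype_apply]

end PrimeSocle

section Irreducible

variable {R : Type*} [CommRing R] {M : Type*} [AddCommGroup M] [Module R M]

lemma colon_singleton_eq_radical_colon {Q : Submodule R M} (hQ : Q.IsPrimary) {x : M}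
    (hx : (Q.colon {x}).IsPrime) : Q.colon {x} = (Q.colon Set.univ).radical := by
  have hxQ : x ∉ Q := fun h =>
    hx.ne_top ((Submodule.colon_eq_top_iff_subset {x}).2 (Set.singleton_subset_iff.2 h))
  rw [← hQ.radical_colon_singleton_of_notMem hxQ, hx.radical]

lemma primeSocleLen_eq_zero_of_isPrimary [IsNoetherianRing R] {Q : Submodule R M}
    (hQ : Q.IsPrimary) {p : PrimeSpectrum R} (hp : (Q.colon Set.univ).radical ≠ p.asIdeal) :
    primeSocleLen p Q = 0 := by
  by_contra h
  obtain ⟨x, hx⟩ := exists_colon_singleton_eq_of_primeSocleLen_ne_zero h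
  rw [← colon_singleton_eq_radical_colon hQ (hx.symm ▸ p.isPrime)] at hp
  exact hp hx

variable [IsNoetherian R M]

lemma primeSocleLen_le_one_of_infIrred {Q : Submodule R M} (hQ : InfIrred Q) {p : PrimeSpectrum R}
    (hp : (Q.colon Set.univ).radical = p.asIdeal) : primeSocleLen p Q ≤ 1 := by
  have hsat (s : p.asIdeal.primeCompl) (x : M) (hsx : s • x ∈ Q) : x ∈ Q :=
    (hQ.isPrimary.mem_or_mem hsx).resolve_right fun h => s.2 (hp.le h)
  refine socleLen_le_one_of_infIrred (infIrred_localized hQ (fun htop => ?_) hsat)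
  refine hQ.isPrimary.ne_top (eq_top_iff.2 fun x _ => ?_)
  obtain ⟨s, hs⟩ := mkLinearMap_mem_localized.1 (htop ▸ Submodule.mem_top :
    LocalizedModule.mkLinearMap p.asIdeal.primeCompl M x ∈ Q.localized p.asIdeal.primeCompl)
  exact hsat s x hs

namespace IsIrredundantDecomposition

variable [IsNoetherianRing R] {N : Submodule R M} {s : Finset (Submodule R M)}

omit [IsNoetherian R M] in
open Classical in
lemma exists_mem_inf_erase (hs : IsIrredundantDecomposition N s) {Q : Submodule R M} (hQ : Q ∈ s) :
    ∃ x ∈ (s.erase Q).inf id, (N.colon {x}).IsPrime ∧ Q.colon {x} = N.colon {x} := by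
  have hinf : Q ⊓ (s.erase Q).inf id = N := by
    rw [← hs.2.1, ← Finset.insert_erase hQ, Finset.inf_insert, Finset.insert_erase hQ, id]
  obtain ⟨x, hx, hprime⟩ := exists_colon_singleton_isPrime (N := N) fun hle =>
    hs.2.2 _ (Finset.erase_ssubset hQ) (le_antisymm hle (hinf ▸ inf_le_right))
  refine ⟨x, hx, hprime, ?_⟩
  rw [← hinf, Submodule.colon_inf_eq_left_of_subset (Set.singleton_subset_iff.2 hx)]

open Classical in
lemma card_filter_le_primeSocleLen (hs : IsIrredundantDecomposition N s) (p : PrimeSpectrum R) :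
    ((s.filter fun Q => (Q.colon Set.univ).radical = p.asIdeal).card : ℕ∞) ≤
      primeSocleLen p N := by
  set t := s.filter fun Q => (Q.colon Set.univ).radical = p.asIdeal
  have hmem (Q : t) : (Q : Submodule R M) ∈ s := (Finset.mem_filter.1 Q.2).1
  choose x hx hprime hcolon using fun Q : t => hs.exists_mem_inf_erase (hmem Q)
  have hQx (Q : t) : (Q : Submodule R M).colon {x Q} = p.asIdeal := by
    rw [colon_singleton_eq_radical_colon (hs.1 _ (hmem Q)).isPrimary (hcolon Q ▸ hprime Q)]
    exact (Finset.mem_filter.1 Q.2).2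
  rw [← Fintype.card_coe]
  refine card_le_primeSocleLen x (fun Q => (hcolon Q ▸ hQx Q).ge) fun c hc Q => ?_
  have hsum : ∑ Q', c Q' • x Q' ∈ (Q : Submodule R M) :=
    (hs.2.1 ▸ Finset.inf_le (hmem Q) : N ≤ Q) hc
  have hrest : ∑ Q' ∈ Finset.univ.erase Q, c Q' • x Q' ∈ (Q : Submodule R M) := by
    refine Submodule.sum_mem _ fun Q' hQ' => Submodule.smul_mem _ _ ?_
    have hne : (Q : Submodule R M) ≠ Q' := fun h => Finset.ne_of_mem_erase hQ' (Subtype.ext h.symm)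
    exact (Finset.inf_le (Finset.mem_erase.2 ⟨hne, hmem Q⟩) : (s.erase Q').inf id ≤ Q) (hx Q')
  rw [← Finset.add_sum_erase _ _ (Finset.mem_univ Q), Submodule.add_mem_iff_left _ hrest] at hsum
  exact (hQx Q).le (Submodule.mem_colon_singleton.2 hsum)

open Classical in
lemma primeSocleLen_le_card_filter (hs : IsIrredundantDecomposition N s) (p : PrimeSpectrum R) :
    primeSocleLen p N ≤
      ((s.filter fun Q => (Q.colon Set.univ).radical = p.asIdeal).card : ℕ∞) := by
  rw [← hs.2.1, Finset.card_filter, Nat.cast_sum]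
  refine (primeSocleLen_finset_inf_le p s).trans (Finset.sum_le_sum fun Q hQ => ?_)
  split_ifs with h
  · exact_mod_cast primeSocleLen_le_one_of_infIrred (hs.1 Q hQ) h
  · exact (primeSocleLen_eq_zero_of_isPrimary (hs.1 Q hQ).isPrimary h).le

lemma card_eq_sum_primeSocleLen (hs : IsIrredundantDecomposition N s)
    {F : Finset (PrimeSpectrum R)}
    (hF : ∀ p : PrimeSpectrum R, p.asIdeal ∈ associatedPrimes R (M ⧸ N) → p ∈ F) :
    (s.card : ℕ∞) = ∑ p ∈ F, primeSocleLen p N := by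
  classical
  have hmaps : ∀ Q ∈ s, (Q.colon Set.univ).radical ∈ F.image PrimeSpectrum.asIdeal := by
    intro Q hQ
    obtain ⟨x, -, hprime, hcolon⟩ := hs.exists_mem_inf_erase hQ
    refine Finset.mem_image.2 ⟨⟨_, hprime⟩, hF _ ?_, ?_⟩
    · exact mem_associatedPrimes_quotient.2 ⟨hprime, x, rfl⟩
    · rw [← colon_singleton_eq_radical_colon (hs.1 Q hQ).isPrimary (hcolon ▸ hprime), hcolon]
  rw [Finset.card_eq_sum_card_fiberwise hmaps,
    Finset.sum_image fun _ _ _ _ h => PrimeSpectrum.ext h, Nat.cast_sum]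
  exact Finset.sum_congr rfl fun p _ =>
    le_antisymm (hs.card_filter_le_primeSocleLen p) (hs.primeSocleLen_le_card_filter p)

end IsIrredundantDecomposition

lemma ir_eq_sum_primeSocleLen [IsNoetherianRing R] (N : Submodule R M)
    {F : Finset (PrimeSpectrum R)}
    (hF : ∀ p : PrimeSpectrum R, p.asIdeal ∈ associatedPrimes R (M ⧸ N) → p ∈ F) :
    (ir N : ℕ∞) = ∑ p ∈ F, primeSocleLen p N := by
  obtain ⟨s, hs⟩ := exists_isIrredundantDecomposition N
  obtain ⟨t, ht, hcard⟩ : ∃ t : Finset (Submodule R M), IsIrredundantDecomposition N t ∧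
      t.card = ir N := Nat.sInf_mem (s := {k | ∃ t : Finset (Submodule R M),
        IsIrredundantDecomposition N t ∧ t.card = k}) ⟨s.card, s, hs, rfl⟩
  rw [← hcard, ht.card_eq_sum_primeSocleLen hF]

end Irreducible

section QuotientDimension

variable {A : Type*} [CommRing A]

lemma length_le_of_ringKrullDim_quotient_le {b : Ideal A} {d : ℕ}
    (hd : ringKrullDim (A ⧸ b) ≤ d) (s : LTSeries (PrimeSpectrum A)) (hs : b ≤ s.head.asIdeal) :
    s.length ≤ d := by
  rw [ringKrullDim_quotient] at hd
  let t : LTSeries (PrimeSpectrum.zeroLocus (b : Set A)) :=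
    { length := s.length
      toFun i := ⟨s i, hs.trans (s.head_le i)⟩
      step i := s.step i }
  exact_mod_cast (Order.LTSeries.length_le_krullDim t).trans hd

lemma ringKrullDim_quotient_le_of_length_le {b : Ideal A} {d : ℕ}
    (h : ∀ s : LTSeries (PrimeSpectrum A), b ≤ s.head.asIdeal → s.length ≤ d) :
    ringKrullDim (A ⧸ b) ≤ d := by
  rw [ringKrullDim_quotient]
  refine iSup_le fun t => ?_
  exact_mod_cast h (t.map Subtype.val fun _ _ => id) t.head.2

lemma isMaximal_of_ringKrullDim_quotient_le_zero {b P : Ideal A} (hP : P.IsPrime) (hb : b ≤ P)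
    (hd : ringKrullDim (A ⧸ b) ≤ 0) : P.IsMaximal := by
  obtain ⟨Q, hQ, hPQ⟩ := P.exists_le_maximal hP.ne_top
  rcases hPQ.eq_or_lt with rfl | hlt
  · exact hQ
  let s : LTSeries (PrimeSpectrum A) :=
    (RelSeries.singleton _ ⟨Q, hQ.isPrime⟩ : LTSeries (PrimeSpectrum A)).cons ⟨P, hP⟩ hlt
  exact absurd (length_le_of_ringKrullDim_quotient_le (d := 0) hd s hb)
    (Nat.not_succ_le_zero 0)

lemma ringKrullDim_quotient_sup_span_singleton_le {b : Ideal A} {y : A} {d : ℕ}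
    (hy : ∀ P ∈ b.minimalPrimes, y ∈ P → P.IsMaximal)
    (hd : ringKrullDim (A ⧸ b) ≤ (d + 1 : ℕ)) :
    ringKrullDim (A ⧸ (b ⊔ Ideal.span {y})) ≤ d := by
  refine ringKrullDim_quotient_le_of_length_le fun s hs => ?_
  obtain ⟨P, hP, hPs⟩ := Ideal.exists_minimalPrimes_le (le_sup_left.trans hs)
  have hys : y ∈ s.head.asIdeal := hs (Ideal.mem_sup_right (Ideal.mem_span_singleton_self y))
  by_cases hyP : y ∈ P
  · suffices s.length = 0 by lia
    by_contra hpos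
    have hlt : s.head < s.last := s.strictMono (Fin.lt_def.2 (show 0 < s.length by lia))
    have hmax := (hy P hP hyP).eq_of_le s.last.2.ne_top (hPs.trans hlt.le)
    exact hlt.not_ge (hmax ▸ hPs : s.last.asIdeal ≤ s.head.asIdeal)
  · have hlt : (⟨P, hP.1.1⟩ : PrimeSpectrum A) < s.head :=
      lt_of_le_not_ge hPs fun h => hyP (h hys)
    simpa using length_le_of_ringKrullDim_quotient_le hd (s.cons ⟨P, hP.1.1⟩ hlt) hP.1.2

lemma ringKrullDim_quotient_comap {B : Type*} [CommRing B] {f : A →+* B}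
    (hf : Function.Surjective f) (b : Ideal B) :
    ringKrullDim (A ⧸ b.comap f) = ringKrullDim (B ⧸ b) :=
  ringKrullDim_eq_of_ringEquiv (RingEquiv.ofBijective (Ideal.quotientMap b f le_rfl)
    ⟨Ideal.quotientMap_injective, Ideal.quotientMap_surjective hf⟩)

end QuotientDimension

section Graded

open scoped HomogeneousIdeal

variable {A : Type*} [CommRing A] {σ : Type*} [SetLike σ A] [AddSubgroupClass σ A] (𝒜 : ℕ → σ)
  [GradedRing 𝒜]

lemma isHomogeneous_of_mem_minimalPrimes {b P : Ideal A} (hb : b.IsHomogeneous 𝒜)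
    (hP : P ∈ b.minimalPrimes) : P.IsHomogeneous 𝒜 := by
  have hle : b ≤ (P.homogeneousCore 𝒜).toIdeal := by
    rw [← hb.toIdeal_homogeneousCore_eq_self]
    exact Ideal.homogeneousCore_mono 𝒜 hP.1.2
  have hcore := Ideal.toIdeal_homogeneousCore_le 𝒜 P
  rw [(hP.2 ⟨hP.1.1.homogeneousCore, hle⟩ hcore).antisymm hcore]
  exact (P.homogeneousCore 𝒜).isHomogeneous

lemma exists_homogeneous_mem_notMem {c P : Ideal A} (hc : c.IsHomogeneous 𝒜) (h : ¬ c ≤ P) :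
    ∃ n, ∃ z ∈ 𝒜 n, z ∈ c ∧ z ∉ P := by
  classical
  obtain ⟨x, hxc, hxP⟩ := SetLike.not_le_iff_exists.1 h
  by_contra! hall
  refine hxP ?_
  rw [← DirectSum.sum_support_decompose 𝒜 x]
  exact Ideal.sum_mem _ fun i _ => hall i _ (SetLike.coe_mem _) (hc i hxc)

lemma eq_zero_of_mem_irrelevant {z : A} (hz : z ∈ 𝒜 0) (h : z ∈ 𝒜₊.toIdeal) : z = 0 := by
  have : (DirectSum.decompose 𝒜 z 0 : A) = 0 := h
  rwa [DirectSum.decompose_of_mem_same 𝒜 hz] at this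

variable {𝒜} in
lemma pow_add_pow_mem_graded {d e : ℕ} {y z : A} (hy : y ∈ 𝒜 d) (hz : z ∈ 𝒜 e) :
    y ^ e + z ^ d ∈ 𝒜 (d * e) := by
  refine add_mem ?_ ?_
  · simpa [mul_comm] using SetLike.pow_mem_graded e hy
  · simpa using SetLike.pow_mem_graded d hz

lemma exists_homogeneous_mem_primes_notMem {T : Finset (Ideal A)} {P : Ideal A} (hP : P.IsPrime)
    (hhom : ∀ Q ∈ T, Q.IsHomogeneous 𝒜) (hirr : ¬ 𝒜₊.toIdeal ≤ P) (hT : ∀ Q ∈ T, ¬ Q ≤ P) :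
    ∃ e, 0 < e ∧ ∃ z ∈ 𝒜 e, z ∉ P ∧ ∀ Q ∈ T, z ∈ Q := by
  have hc : (𝒜₊.toIdeal ⊓ T.inf id).IsHomogeneous 𝒜 := by
    refine (HomogeneousIdeal.isHomogeneous _).inf ?_
    rw [Finset.inf_eq_iInf]
    exact Ideal.IsHomogeneous.iInf₂ hhom
  have hnle : ¬ 𝒜₊.toIdeal ⊓ T.inf id ≤ P := by
    rw [hP.inf_le, hP.inf_le', not_or]
    exact ⟨hirr, fun ⟨Q, hQ, hQP⟩ => hT Q hQ hQP⟩
  obtain ⟨e, z, hze, ⟨hzirr, hzT⟩, hzP⟩ := exists_homogeneous_mem_notMem 𝒜 hc hnle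
  refine ⟨e, Nat.pos_of_ne_zero ?_, z, hze, hzP, fun Q hQ => (Finset.inf_le hQ : T.inf id ≤ Q) hzT⟩
  rintro rfl
  exact hzP (eq_zero_of_mem_irrelevant 𝒜 hze hzirr ▸ P.zero_mem)

lemma exists_homogeneous_forall_notMem (T : Finset (Ideal A))
    (hprime : ∀ P ∈ T, P.IsPrime) (hhom : ∀ P ∈ T, P.IsHomogeneous 𝒜)
    (hirr : ∀ P ∈ T, ¬ 𝒜₊.toIdeal ≤ P) (hanti : IsAntichain (· ≤ ·) (T : Set (Ideal A))) :
    ∃ d, 0 < d ∧ ∃ y ∈ 𝒜 d, ∀ P ∈ T, y ∉ P := by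
  classical
  induction T using Finset.induction_on with
  | empty => exact ⟨1, one_pos, 0, zero_mem _, by simp⟩
  | insert P T hPT ih =>
    rw [Finset.forall_mem_insert] at hprime hhom hirr
    rw [Finset.coe_insert] at hanti
    obtain ⟨d, hd, y, hyd, hy⟩ := ih hprime.2 hhom.2 hirr.2 (hanti.subset (Set.subset_insert _ _))
    by_cases hyP : y ∈ P
    swap
    · exact ⟨d, hd, y, hyd, (Finset.forall_mem_insert _ _ _).2 ⟨hyP, hy⟩⟩
    obtain ⟨e, he, z, hze, hzP, hzT⟩ := exists_homogeneous_mem_primes_notMem 𝒜 hprime.1 hhom.2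
      hirr.1 fun Q hQ => hanti (Set.mem_insert_of_mem P hQ) (Set.mem_insert P _)
        (ne_of_mem_of_not_mem hQ hPT)
    refine ⟨d * e, Nat.mul_pos hd he, _, pow_add_pow_mem_graded hyd hze,
      (Finset.forall_mem_insert _ _ _).2 ⟨fun hmem => ?_, fun Q hQ hmem => ?_⟩⟩
    · rw [Ideal.add_mem_iff_right _ (Ideal.pow_mem_of_mem _ hyP e he)] at hmem
      exact hzP (hprime.1.mem_of_pow_mem d hmem)
    · rw [Ideal.add_mem_iff_left _ (Ideal.pow_mem_of_mem _ (hzT Q hQ) d hd)] at hmem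
      exact hy Q hQ ((hprime.2 Q hQ).mem_of_pow_mem e hmem)

lemma exists_homogeneous_forall_minimalPrimes_notMem [IsNoetherianRing A] {b : Ideal A}
    (hb : b.IsHomogeneous 𝒜) :
    ∃ d, 0 < d ∧ ∃ y ∈ 𝒜 d, ∀ P ∈ b.minimalPrimes, y ∈ P → 𝒜₊.toIdeal ≤ P := by
  classical
  set T := b.finite_minimalPrimes_of_isNoetherianRing.toFinset.filter (¬ 𝒜₊.toIdeal ≤ ·) with hT
  have hmem : ∀ P, P ∈ T ↔ P ∈ b.minimalPrimes ∧ ¬ 𝒜₊.toIdeal ≤ P := fun P => by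
    rw [hT, Finset.mem_filter, Set.Finite.mem_toFinset]
  obtain ⟨d, hd, y, hyd, hy⟩ := exists_homogeneous_forall_notMem 𝒜 T
    (fun P hP => ((hmem P).1 hP).1.1.1)
    (fun P hP => isHomogeneous_of_mem_minimalPrimes 𝒜 hb ((hmem P).1 hP).1)
    (fun P hP => ((hmem P).1 hP).2)
    fun P hP Q hQ hne hle => hne (hle.antisymm (((hmem Q).1 hQ).1.2 ((hmem P).1 hP).1.1 hle))
  exact ⟨d, hd, y, hyd, fun P hP hyP => by_contra fun hirr => hy P ((hmem P).2 ⟨hP, hirr⟩) hyP⟩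

lemma sup_irrelevant_ne_top {P : Ideal A} (hP : P.IsHomogeneous 𝒜) (hne : P ≠ ⊤) :
    P ⊔ 𝒜₊.toIdeal ≠ ⊤ := by
  rw [Ne, Ideal.eq_top_iff_one, Submodule.mem_sup]
  rintro ⟨x, hx, y, hy, hxy⟩
  have hy₀ : (DirectSum.decompose 𝒜 y 0 : A) = 0 := hy
  have h₁ : (DirectSum.decompose 𝒜 (x + y) 0 : A) = 1 := by
    rw [hxy, DirectSum.decompose_of_mem_same 𝒜 SetLike.GradedOne.one_mem]
  rw [DirectSum.decompose_add, DirectSum.add_apply, AddMemClass.coe_add, hy₀, add_zero] at h₁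
  exact hne ((Ideal.eq_top_iff_one P).2 (h₁ ▸ hP 0 hx))

lemma irrelevant_le_radical_of_ringKrullDim_quotient_le_zero {b : Ideal A}
    (hb : b.IsHomogeneous 𝒜) (hd : ringKrullDim (A ⧸ b) ≤ 0) : 𝒜₊.toIdeal ≤ b.radical := by
  rw [← Ideal.sInf_minimalPrimes]
  refine le_sInf fun P hP => ?_
  have hne := sup_irrelevant_ne_top 𝒜 (isHomogeneous_of_mem_minimalPrimes 𝒜 hb hP) hP.1.1.ne_top
  have hmax := isMaximal_of_ringKrullDim_quotient_le_zero hP.1.1 hP.1.2 hd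
  exact le_sup_right.trans (hmax.eq_of_le hne le_sup_left).ge

lemma exists_homogeneous_parameters [IsNoetherianRing A] {d : ℕ} {b : Ideal A}
    (hb : b.IsHomogeneous 𝒜)
    (hmax : ∀ P : Ideal A, P.IsPrime → b ≤ P → 𝒜₊.toIdeal ≤ P → P.IsMaximal)
    (hd : ringKrullDim (A ⧸ b) ≤ d) :
    ∃ e ≠ 0, ∃ s : Finset A, s.card ≤ d ∧ (∀ y ∈ s, y ∈ 𝒜 e) ∧
      𝒜₊.toIdeal ≤ (b ⊔ Ideal.span (s : Set A)).radical := by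
  classical
  induction d generalizing b with
  | zero =>
    refine ⟨1, one_ne_zero, ∅, le_rfl, by simp, ?_⟩
    exact (irrelevant_le_radical_of_ringKrullDim_quotient_le_zero 𝒜 hb (by exact_mod_cast hd)).trans
      (Ideal.radical_mono le_sup_left)
  | succ d ih =>
    obtain ⟨e₀, he₀, y, hy, hymin⟩ := exists_homogeneous_forall_minimalPrimes_notMem 𝒜 hb
    obtain ⟨e₁, he₁, t, htcard, ht, hrad⟩ := ih
      (hb.sup (Ideal.homogeneous_span 𝒜 _ (by rintro _ rfl; exact ⟨e₀, hy⟩)))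
      (fun P hP hle => hmax P hP (le_sup_left.trans hle))
      (ringKrullDim_quotient_sup_span_singleton_le
        (fun P hP hyP => hmax P hP.1.1 hP.1.2 (hymin P hP hyP)) hd)
    have hspan : ∀ z ∈ insert (y ^ e₁) (t.image (· ^ e₀)),
        z ∈ b ⊔ Ideal.span (insert (y ^ e₁) (t.image (· ^ e₀)) : Finset A) :=
      fun z hz => Ideal.mem_sup_right (Ideal.subset_span hz)
    refine ⟨e₀ * e₁, mul_ne_zero he₀.ne' he₁, insert (y ^ e₁) (t.image (· ^ e₀)), ?_, ?_, ?_⟩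
    · exact (Finset.card_insert_le _ _).trans
        (Nat.succ_le_succ (Finset.card_image_le.trans htcard))
    · rw [Finset.forall_mem_insert, Finset.forall_mem_image]
      refine ⟨?_, fun z hz => ?_⟩
      · simpa [mul_comm] using SetLike.pow_mem_graded e₁ hy
      · simpa using SetLike.pow_mem_graded e₀ (ht z hz)
    · refine hrad.trans (Ideal.radical_le_radical_iff.2 (sup_le (sup_le ?_ ?_) ?_))
      · exact le_sup_left.trans Ideal.le_radical
      · rw [Ideal.span_singleton_le_iff_mem]
        exact ⟨e₁, hspan _ (Finset.mem_insert_self _ _)⟩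
      · exact Ideal.span_le.2 fun z hz => ⟨e₀, hspan _
          (Finset.mem_insert_of_mem (Finset.mem_image_of_mem _ hz))⟩

end Graded

section ReesPresentation

open MvPolynomial

open scoped HomogeneousIdeal

variable {R : Type*} [CommRing R] {M : Type*} [AddCommGroup M] [Module R M] {ι : Type*}
  (a : ι → R)

/-- The homomorphism `R[Xᵢ] → R[t]`, `Xᵢ ↦ aᵢ t`, whose image is the Rees algebra of the ideal
generated by the `aᵢ`. -/
noncomputable def reesHom : MvPolynomial ι R →ₐ[R] Polynomial R :=
  aeval fun i => Polynomial.monomial 1 (a i)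

lemma reesHom_monomial (d : ι →₀ ℕ) (c : R) :
    reesHom a (monomial d c) = Polynomial.monomial d.degree (eval a (monomial d c)) := by
  simp_rw [reesHom, aeval_monomial, eval_monomial, Finsupp.prod, Finsupp.degree_apply,
    Polynomial.monomial_pow, one_mul, Polynomial.algebraMap_eq, ← Polynomial.C_mul_monomial,
    ← Polynomial.C_mul_X_pow_eq_monomial, Finset.prod_mul_distrib, Finset.prod_pow_eq_pow_sum,
    map_prod]

lemma coeff_reesHom (F : MvPolynomial ι R) (n : ℕ) :
    (reesHom a F).coeff n = eval a (homogeneousComponent n F) := by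
  induction F using MvPolynomial.induction_on' with
  | monomial d c =>
    rw [reesHom_monomial, Polynomial.coeff_monomial,
      homogeneousComponent_of_mem (isHomogeneous_monomial c rfl), apply_ite (eval a), map_zero]
    simp only [eq_comm]
  | add p q hp hq => simp only [map_add, Polynomial.coeff_add, hp, hq]

lemma coeff_reesHom_mem (F : MvPolynomial ι R) (n : ℕ) :
    (reesHom a F).coeff n ∈ Ideal.span (Set.range a) ^ n := by
  rw [Ideal.mem_span_pow_iff_exists_isHomogeneous]
  exact ⟨_, homogeneousComponent_isHomogeneous n F, (coeff_reesHom a F n).symm⟩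

lemma reesHom_of_isHomogeneous {F : MvPolynomial ι R} {k : ℕ} (hF : F.IsHomogeneous k) :
    reesHom a F = Polynomial.monomial k (eval a F) := by
  ext n
  rw [coeff_reesHom, homogeneousComponent_of_mem hF, Polynomial.coeff_monomial,
    apply_ite (eval a), map_zero]
  simp only [eq_comm]

lemma coeff_reesHom_mem_of_mem_span [DecidableEq R] {Y : Finset (MvPolynomial ι R)} {e : ℕ}
    (hY : ∀ y ∈ Y, y.IsHomogeneous e) {F : MvPolynomial ι R}
    (hF : F ∈ Ideal.span (Y : Set (MvPolynomial ι R))) (n : ℕ) :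
    (reesHom a F).coeff (n + e) ∈
      Ideal.span (Y.image (eval a) : Set R) * Ideal.span (Set.range a) ^ n := by
  obtain ⟨G, -, rfl⟩ := Submodule.mem_span_finset.1 hF
  rw [map_sum, Polynomial.finsetSum_coeff]
  refine sum_mem fun y hy => ?_
  rw [smul_eq_mul, map_mul, reesHom_of_isHomogeneous a (hY y hy), Polynomial.coeff_mul_monomial]
  exact Ideal.mul_mem_mul_rev (Ideal.subset_span (Finset.mem_coe.2 (Finset.mem_image_of_mem _ hy)))
    (coeff_reesHom_mem a (G y) n)

/-- The annihilator in `R[Xᵢ]` of the graded module `⨁ₙ Iⁿ M / Iⁿ W`, where `I` is generated by the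
`aᵢ` and `Xᵢ` acts as `aᵢ t`; only elements `x` of degree `0` have to be tested. -/
noncomputable def gradedAnnihilator (W : Submodule R M) : Ideal (MvPolynomial ι R) where
  carrier := {F | ∀ n x, (reesHom a F).coeff n • x ∈ Ideal.span (Set.range a) ^ n • W}
  add_mem' hF hG n x := by
    rw [map_add, Polynomial.coeff_add, add_smul]
    exact Submodule.add_mem _ (hF n x) (hG n x)
  zero_mem' n x := by
    rw [map_zero, Polynomial.coeff_zero, zero_smul]
    exact Submodule.zero_mem _
  smul_mem' G F hF n x := by
    rw [smul_eq_mul, map_mul, Polynomial.coeff_mul, Finset.sum_smul]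
    refine Submodule.sum_mem _ fun ij hij => ?_
    rw [← Finset.HasAntidiagonal.mem_antidiagonal.1 hij, mul_smul, pow_add, mul_smul]
    exact Submodule.smul_mem_smul (coeff_reesHom_mem a G ij.1) (hF ij.2 x)

variable {a} {W : Submodule R M}

lemma mem_gradedAnnihilator {F : MvPolynomial ι R} : F ∈ gradedAnnihilator a W ↔
    ∀ n x, (reesHom a F).coeff n • x ∈ Ideal.span (Set.range a) ^ n • W := Iff.rfl

lemma mem_gradedAnnihilator_of_isHomogeneous {F : MvPolynomial ι R} {k : ℕ}
    (hF : F.IsHomogeneous k) :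
    F ∈ gradedAnnihilator a W ↔ ∀ x, eval a F • x ∈ Ideal.span (Set.range a) ^ k • W := by
  rw [mem_gradedAnnihilator, reesHom_of_isHomogeneous a hF]
  refine ⟨fun h x => by simpa using h k x, fun h n x => ?_⟩
  rw [Polynomial.coeff_monomial]
  split_ifs with hn
  · exact hn ▸ h x
  · rw [zero_smul]
    exact Submodule.zero_mem _

attribute [local instance] MvPolynomial.gradedAlgebra

lemma isHomogeneous_gradedAnnihilator :
    (gradedAnnihilator a W).IsHomogeneous (homogeneousSubmodule ι R) := by
  intro n F hF
  have hcomp : (DirectSum.decompose (homogeneousSubmodule ι R) F n : MvPolynomial ι R) =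
    homogeneousComponent n F := decomposition.decompose'_apply F n
  rw [hcomp, mem_gradedAnnihilator_of_isHomogeneous (homogeneousComponent_isHomogeneous n F),
    ← coeff_reesHom]
  exact hF n

lemma map_C_le_gradedAnnihilator {c : Ideal R} :
    c.map C ≤ gradedAnnihilator a (c • (⊤ : Submodule R M)) := by
  refine Ideal.map_le_iff_le_comap.2 fun x hx => ?_
  rw [Ideal.mem_comap, mem_gradedAnnihilator_of_isHomogeneous (isHomogeneous_C _ x)]
  intro u
  rw [eval_C, pow_zero, Ideal.one_eq_top, Submodule.top_smul]
  exact Submodule.smul_mem_smul hx trivial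

lemma idealOfVars_le_irrelevant :
    idealOfVars ι R ≤ (homogeneousSubmodule ι R)₊.toIdeal := by
  rw [idealOfVars, Ideal.span_le]
  rintro _ ⟨i, rfl⟩
  exact HomogeneousIdeal.mem_irrelevant_of_mem _ one_pos (isHomogeneous_X R i)

lemma mem_idealOfVars_pow_of_isHomogeneous {F : MvPolynomial ι R} {k n : ℕ}
    (hF : F.IsHomogeneous k) (h : n ≤ k) : F ∈ idealOfVars ι R ^ n := by
  refine (mem_pow_idealOfVars_iff' n F).2 fun x hx => hF.coeff_eq_zero ?_
  lia

lemma sub_C_constantCoeff_mem_idealOfVars (F : MvPolynomial ι R) :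
    F - C (constantCoeff F) ∈ idealOfVars ι R := by
  rw [← pow_one (idealOfVars ι R), mem_pow_idealOfVars_iff']
  intro x hx
  rw [(Finsupp.degree_eq_zero_iff x).1 (Nat.lt_one_iff.1 hx), coeff_sub, coeff_zero_C,
    constantCoeff_eq, sub_self]

lemma isMaximal_of_idealOfVars_le [IsLocalRing R] {P : Ideal (MvPolynomial ι R)}
    (hP : P.IsPrime) (hm : (IsLocalRing.maximalIdeal R).map C ≤ P)
    (hvars : idealOfVars ι R ≤ P) : P.IsMaximal := by
  let f : MvPolynomial ι R →+* IsLocalRing.ResidueField R :=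
    (IsLocalRing.residue R).comp constantCoeff
  have hf : Function.Surjective f :=
    IsLocalRing.residue_surjective.comp fun r => ⟨C r, constantCoeff_C _ r⟩
  have hker : (RingHom.ker f).IsMaximal := RingHom.ker_isMaximal_of_surjective f hf
  suffices RingHom.ker f ≤ P from hker.eq_of_le hP.ne_top this ▸ hker
  intro F hF
  have hF₀ : constantCoeff F ∈ IsLocalRing.maximalIdeal R :=
    (IsLocalRing.residue_eq_zero_iff _).1 hF
  rw [← sub_add_cancel F (C (constantCoeff F))]
  exact P.add_mem (hvars (sub_C_constantCoeff_mem_idealOfVars F))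
    (hm (Ideal.mem_map_of_mem C hF₀))

open Classical in
lemma pow_smul_top_le_sup {Y : Finset (MvPolynomial ι R)} {e n : ℕ}
    (hY : ∀ y ∈ Y, y.IsHomogeneous e)
    (hn : idealOfVars ι R ^ n ≤
      gradedAnnihilator a W ⊔ Ideal.span (Y : Set (MvPolynomial ι R))) :
    Ideal.span (Set.range a) ^ (n + e) • (⊤ : Submodule R M) ≤
      Ideal.span (Y.image (eval a) : Set R) • Ideal.span (Set.range a) ^ n • ⊤ ⊔
        Ideal.span (Set.range a) ^ (n + e) • W := by
  refine Submodule.smul_le.2 fun r hr x _ => ?_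
  obtain ⟨F, hF, rfl⟩ := (Ideal.mem_span_pow_iff_exists_isHomogeneous _ _).1 hr
  obtain ⟨G, hG, H, hH, rfl⟩ := Submodule.mem_sup.1
    (hn (mem_idealOfVars_pow_of_isHomogeneous hF (Nat.le_add_right n e)))
  have heval : eval a (G + H) =
      (reesHom a H).coeff (n + e) + (reesHom a G).coeff (n + e) := by
    rw [← Polynomial.coeff_add, ← map_add, add_comm H, reesHom_of_isHomogeneous a hF,
      Polynomial.coeff_monomial_same]
  rw [heval, add_smul, ← mul_smul]
  exact Submodule.add_mem_sup
    (Submodule.smul_mem_smul (coeff_reesHom_mem_of_mem_span a hY hH n) trivial) (hG (n + e) x)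

lemma exists_isReduction_of_ringKrullDim_le [IsLocalRing R] [IsNoetherianRing R]
    [Module.Finite R M] [Finite ι] {d : ℕ}
    (hd : ringKrullDim (MvPolynomial ι R ⧸
      gradedAnnihilator a (IsLocalRing.maximalIdeal R • (⊤ : Submodule R M))) ≤ d) :
    ∃ e ≠ 0, ∃ s : Finset R, s.card ≤ d ∧
      IsReduction (Ideal.span (s : Set R)) (Ideal.span (Set.range a) ^ e) M := by
  classical
  obtain ⟨e, he, Y, hcard, hY, hrad⟩ := exists_homogeneous_parameters (homogeneousSubmodule ι R)
    isHomogeneous_gradedAnnihilator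
    (fun P hP hbP hirr => isMaximal_of_idealOfVars_le hP (map_C_le_gradedAnnihilator.trans hbP)
      (idealOfVars_le_irrelevant.trans hirr)) hd
  obtain ⟨n, hn⟩ := Ideal.exists_pow_le_of_le_radical_of_fg
    (idealOfVars_le_irrelevant.trans hrad) (idealOfVars_fg ι R)
  have hle : Ideal.span (Y.image (eval a) : Set R) ≤ Ideal.span (Set.range a) ^ e := by
    refine Ideal.span_le.2 fun r hr => ?_
    obtain ⟨y, hy, rfl⟩ := Finset.mem_image.1 (Finset.mem_coe.1 hr)
    exact (Ideal.mem_span_pow_iff_exists_isHomogeneous _ _).2 ⟨y, hY y hy, rfl⟩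
  refine ⟨e, he, Y.image (eval a), Finset.card_image_le.trans hcard,
    IsReduction.of_pow_smul_le (n := n) he hle ?_⟩
  refine Submodule.le_of_le_smul_of_le_jacobson_bot (I := IsLocalRing.maximalIdeal R)
    (IsNoetherian.noetherian _) (IsLocalRing.jacobson_eq_maximalIdeal ⊥ bot_ne_top).ge ?_
  rw [← mul_smul (IsLocalRing.maximalIdeal R), mul_comm, mul_smul]
  exact pow_smul_top_le_sup hY hn

end ReesPresentation

section FibreCone

open Polynomial

lemma map_smul_top_le {R S N : Type*} [CommRing R] [CommRing S] [AddCommGroup N] [Module S N]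
    {f : R →+* S} {c : Ideal R} {L : Submodule S N} (h : ∀ x ∈ c, ∀ u : N, f x • u ∈ L) :
    c.map f • (⊤ : Submodule S N) ≤ L := by
  have hle : c.map f ≤ L.colon ⊤ := Ideal.map_le_iff_le_comap.2 fun x hx =>
    Submodule.mem_colon.2 fun u _ => h x hx u
  exact Submodule.smul_le.2 fun x hx u hu => Submodule.mem_colon.1 (hle hx) u hu

variable {R : Type*} [CommRing R] {M : Type*} [AddCommGroup M] [Module R M] {I : Ideal R}

lemma single_mem_reesModule {k : ℕ} {y : M} (hy : y ∈ I ^ k • (⊤ : Submodule R M)) :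
    PolynomialModule.single R k y ∈ (I.stableFiltration (⊤ : Submodule R M)).submodule := by
  intro n
  rw [Ideal.stableFiltration_N, PolynomialModule.coeff_single, Finsupp.single_apply]
  split_ifs with h
  · exact h ▸ hy
  · exact Submodule.zero_mem _

lemma algebraMap_smul_coeff (c : R) (u : ReesModule R M I) (n : ℕ) :
    (algebraMap R (reesAlgebra I) c • u).1.coeff n = c • u.1.coeff n := by
  have : (algebraMap R (reesAlgebra I) c • u).1 = monomial 0 c • u.1 := rfl
  rw [this, PolynomialModule.monomial_smul_apply]
  simp

variable (I) in
/-- The submodule `⨁ₙ Iⁿ W tⁿ` of the Rees module `⨁ₙ Iⁿ M tⁿ`. -/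
noncomputable def reesSubmodule (W : Submodule R M) :
    Submodule (reesAlgebra I) (ReesModule R M I) :=
  (I.stableFiltration W).submodule.comap (Submodule.subtype _)

lemma mem_reesSubmodule {W : Submodule R M} {u : ReesModule R M I} :
    u ∈ reesSubmodule I W ↔ ∀ n, u.1.coeff n ∈ I ^ n • W := Iff.rfl

lemma map_smul_top_le_reesSubmodule (c : Ideal R) :
    c.map (algebraMap R (reesAlgebra I)) • (⊤ : Submodule (reesAlgebra I) (ReesModule R M I)) ≤
      reesSubmodule I (c • ⊤) := by
  refine map_smul_top_le fun x hx u => mem_reesSubmodule.2 fun n => ?_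
  rw [algebraMap_smul_coeff, ← mul_smul, mul_comm, mul_smul]
  exact Submodule.smul_mem_smul hx (u.2 n)

lemma finite_reesModule [IsNoetherianRing R] [Module.Finite R M] :
    Module.Finite (reesAlgebra I) (ReesModule R M I) :=
  Module.Finite.iff_fg.2 ((Ideal.Filtration.submodule_fg_iff_stable _
    fun _ => IsNoetherian.noetherian _).2 (I.stableFiltration_stable ⊤))

lemma finite_grModule [IsNoetherianRing R] [Module.Finite R M] :
    Module.Finite (GrRing R I) (GrModule R M I) := by
  have := finite_reesModule (R := R) (M := M) (I := I)
  exact inferInstanceAs (Module.Finite (reesAlgebra I ⧸ reesExt R I) (ReesModule R M I ⧸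
    (reesExt R I • (⊤ : Submodule (reesAlgebra I) (ReesModule R M I)))))

variable (I) in
/-- The projection from the Rees algebra to the associated graded ring. -/
noncomputable def grMk : reesAlgebra I →+* GrRing R I := Ideal.Quotient.mk (reesExt R I)

lemma grMk_surjective : Function.Surjective (grMk I) := Ideal.Quotient.mk_surjective

variable (M I) in
/-- The projection from the Rees module to the associated graded module; the scalars change along
`grMk I`. -/
noncomputable def grModuleMk : ReesModule R M I →ₛₗ[grMk I] GrModule R M I where
  __ := (Submodule.mkQ (reesExt R I • (⊤ : Submodule (reesAlgebra I)
    (ReesModule R M I)))).toAddMonoidHom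
  map_smul' _ _ := rfl

lemma grModuleMk_surjective : Function.Surjective (grModuleMk M I) :=
  Submodule.mkQ_surjective _

lemma mem_of_grModuleMk_eq_zero {u : ReesModule R M I} (h : grModuleMk M I u = 0) :
    u ∈ reesExt R I • (⊤ : Submodule (reesAlgebra I) (ReesModule R M I)) :=
  (Submodule.Quotient.mk_eq_zero _).1 h

variable (M I) in
/-- The submodule `c G_M(I)` of the associated graded module, for an ideal `c` of `R`. -/
noncomputable abbrev grExt (c : Ideal R) : Submodule (GrRing R I) (GrModule R M I) :=
  c.map (algebraMap R (GrRing R I)) • ⊤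

instance : RingHomSurjective (grMk I) := ⟨grMk_surjective⟩

lemma grExt_le_map_reesSubmodule (c : Ideal R) :
    grExt M I c ≤ (reesSubmodule I (c • ⊤)).map (grModuleMk M I) := by
  refine map_smul_top_le fun x hx z => ?_
  obtain ⟨w, rfl⟩ := grModuleMk_surjective z
  exact ⟨algebraMap R (reesAlgebra I) x • w, map_smul_top_le_reesSubmodule c
    (Submodule.smul_mem_smul (Ideal.mem_map_of_mem _ hx) trivial), rfl⟩

lemma mem_reesSubmodule_of_grModuleMk_mem {c : Ideal R} (hIc : I ≤ c) {u : ReesModule R M I}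
    (hu : grModuleMk M I u ∈ grExt M I c) :
    u ∈ reesSubmodule I (c • (⊤ : Submodule R M)) := by
  obtain ⟨w, hw, hwu⟩ := grExt_le_map_reesSubmodule c hu
  have hker : u - w ∈ reesSubmodule I (c • (⊤ : Submodule R M)) := by
    refine map_smul_top_le_reesSubmodule c (Submodule.smul_mono_left (Ideal.map_mono hIc) ?_)
    exact mem_of_grModuleMk_eq_zero (by rw [map_sub, hwu, sub_self])
  simpa using Submodule.add_mem _ hker hw

variable {ι : Type*} (a : ι → R)

/-- The homomorphism `R[Xᵢ] → G(I)` sending `Xᵢ` to the class of `aᵢ` in `I / I²`, where `I` is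
generated by the `aᵢ`. -/
noncomputable def grHom : MvPolynomial ι R →+* GrRing R (Ideal.span (Set.range a)) :=
  (grMk _).comp ((reesHom a : MvPolynomial ι R →+* R[X]).codRestrict (reesAlgebra _)
    (coeff_reesHom_mem a))

lemma reesAlgebra_le_range_reesHom :
    reesAlgebra (Ideal.span (Set.range a)) ≤ (reesHom a).range := by
  rw [← adjoin_monomial_eq_reesAlgebra, Algebra.adjoin_le_iff]
  rintro _ ⟨c, hc, rfl⟩
  rw [SetLike.mem_coe, ← pow_one (Ideal.span _),
    Ideal.mem_span_pow_iff_exists_isHomogeneous] at hc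
  obtain ⟨F, hF, rfl⟩ := hc
  exact ⟨F, reesHom_of_isHomogeneous a hF⟩

lemma grHom_surjective : Function.Surjective (grHom a) := by
  rw [grHom, RingHom.coe_comp]
  refine grMk_surjective.comp fun p => ?_
  obtain ⟨F, hF⟩ := reesAlgebra_le_range_reesHom a p.2
  exact ⟨F, Subtype.ext hF⟩

lemma comap_annihilator_le_gradedAnnihilator {c : Ideal R} (hc : Ideal.span (Set.range a) ≤ c) :
    (Module.annihilator (GrRing R (Ideal.span (Set.range a)))
      (GrModule R M (Ideal.span (Set.range a)) ⧸ grExt M _ c)).comap (grHom a) ≤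
      gradedAnnihilator a (c • (⊤ : Submodule R M)) := by
  intro F hF n x
  let g : reesAlgebra (Ideal.span (Set.range a)) := ⟨reesHom a F, coeff_reesHom_mem a F⟩
  let u : ReesModule R M (Ideal.span (Set.range a)) :=
    ⟨PolynomialModule.single R 0 x, single_mem_reesModule (by simp)⟩
  have hgu : grModuleMk M _ (g • u) ∈ grExt M _ c :=
    (Submodule.Quotient.mk_eq_zero _).1
      (Module.mem_annihilator.1 (Ideal.mem_comap.1 hF) (Submodule.Quotient.mk (grModuleMk M _ u)))
  have hcoeff : (g • u).1.coeff n = (reesHom a F).coeff n • x := by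
    change (reesHom a F • PolynomialModule.single R 0 x).coeff n = _
    rw [PolynomialModule.smul_single_apply]
    simp
  exact hcoeff ▸ mem_reesSubmodule.1 (mem_reesSubmodule_of_grModuleMk_mem hc hgu) n

lemma exists_isReduction_of_localAnalyticSpread_le [IsNoetherianRing R] [IsLocalRing R]
    [Module.Finite R M] (hI : I ≤ IsLocalRing.maximalIdeal R) {d : ℕ}
    (hd : localAnalyticSpread R M I ≤ d) :
    ∃ e ≠ 0, ∃ s : Finset R, s.card ≤ d ∧ IsReduction (Ideal.span (s : Set R)) (I ^ e) M := by
  obtain ⟨r, a, rfl : Ideal.span (Set.range a) = I⟩ :=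
    Submodule.fg_iff_exists_fin_generating_family.1 (IsNoetherian.noetherian I)
  have := finite_grModule (R := R) (M := M) (I := Ideal.span (Set.range a))
  refine exists_isReduction_of_ringKrullDim_le ((ringKrullDim_le_of_surjective _
    (Ideal.Quotient.factor_surjective (comap_annihilator_le_gradedAnnihilator a hI))).trans ?_)
  rw [ringKrullDim_quotient_comap (grHom_surjective a),
    ← Module.supportDim_eq_ringKrullDim_quotient_annihilator]
  exact hd

end FibreCone

section AssociatedPrimes

lemma mem_associatedPrimes_of_mem_minimalPrimes_colon {A E : Type*} [CommRing A]
    [IsNoetherianRing A] [AddCommGroup E] [Module A E] {L : Submodule A E} {x : E} {q : Ideal A}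
    (hq : q ∈ (L.colon {x}).minimalPrimes) : q ∈ associatedPrimes A (E ⧸ L) := by
  have hann : Module.annihilator A (Submodule.span A {L.mkQ x}) = L.colon {x} := by
    ext c
    rw [← Submodule.annihilator, Submodule.mem_annihilator_span_singleton,
      Submodule.mem_colon_singleton, ← map_smul, Submodule.mkQ_apply,
      Submodule.Quotient.mk_eq_zero]
  refine associatedPrimes.subset_of_injective (Submodule.subtype_injective _)
    (Module.associatedPrimes.minimalPrimes_annihilator_subset_associatedPrimes A
      (Submodule.span A {L.mkQ x}) ?_)
  rwa [hann]

variable {R : Type*} [CommRing R] {M : Type*} [AddCommGroup M] [Module R M]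

lemma colon_singleton_smul {N : Submodule R M} {x : M} (hp : (N.colon {x}).IsPrime) {c : R}
    (hc : c ∉ N.colon {x}) : N.colon {c • x} = N.colon {x} := by
  ext r
  rw [Submodule.mem_colon_singleton, ← mul_smul, ← Submodule.mem_colon_singleton,
    hp.mul_mem_iff_mem_or_mem, or_iff_left hc]

lemma exists_colon_pow_succ_smul_eq {I : Ideal R} {n : ℕ} {x : M}
    (hp : ((I ^ n • (⊤ : Submodule R M)).colon {x}).IsPrime) :
    ∃ k, ∃ y ∈ I ^ k • (⊤ : Submodule R M), (I ^ (k + 1) • (⊤ : Submodule R M)).colon {y} =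
      (I ^ n • (⊤ : Submodule R M)).colon {x} := by
  induction n with
  | zero => exact absurd ((Ideal.eq_top_iff_one _).2 (by simp)) hp.ne_top
  | succ n ih =>
    by_cases h : (I ^ n • (⊤ : Submodule R M)).colon {x} ≤
      (I ^ (n + 1) • (⊤ : Submodule R M)).colon {x}
    · have heq := h.antisymm (Submodule.colon_mono (antitone_pow_smul I ⊤ n.le_succ) le_rfl)
      exact heq ▸ ih (heq ▸ hp)
    · obtain ⟨r, hr, hrp⟩ := SetLike.not_le_iff_exists.1 h
      exact ⟨n, r • x, Submodule.mem_colon_singleton.1 hr, colon_singleton_smul hp hrp⟩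

lemma comap_colon_reesSubmodule {I : Ideal R} {W : Submodule R M} {k : ℕ} {y : M}
    (hy : PolynomialModule.single R k y ∈ (I.stableFiltration (⊤ : Submodule R M)).submodule) :
    ((reesSubmodule I W).colon {⟨_, hy⟩}).comap (algebraMap R (reesAlgebra I)) =
      (I ^ k • W).colon {y} := by
  ext r
  rw [Ideal.mem_comap, Submodule.mem_colon_singleton, mem_reesSubmodule,
    Submodule.mem_colon_singleton]
  simp only [algebraMap_smul_coeff, PolynomialModule.coeff_single, Finsupp.single_apply]
  refine ⟨fun h => by simpa using h k, fun h n => ?_⟩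
  split_ifs with hn
  · exact hn ▸ h
  · simp

-- The associated primes of all `Iⁿ M / Iⁿ⁺¹ M` are contracted from those of the associated graded
-- module, a finite module over the Noetherian Rees algebra.
lemma finite_setOf_mem_associatedPrimes_pow [IsNoetherianRing R] [Module.Finite R M]
    (I : Ideal R) : {p : PrimeSpectrum R | ∃ n,
      p.asIdeal ∈ associatedPrimes R (M ⧸ (I ^ n • (⊤ : Submodule R M)))}.Finite := by
  have := finite_reesModule (R := R) (M := M) (I := I)
  refine (((associatedPrimes.finite (reesAlgebra I) (ReesModule R M I ⧸ reesSubmodule I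
    (I • ⊤))).image (Ideal.comap (algebraMap R (reesAlgebra I)))).preimage
      (f := PrimeSpectrum.asIdeal) fun _ _ _ _ h => PrimeSpectrum.ext h).subset ?_
  rintro p ⟨n, hp⟩
  obtain ⟨hprime, x, hx⟩ := mem_associatedPrimes_quotient.1 hp
  obtain ⟨k, y, hyk, hy⟩ := exists_colon_pow_succ_smul_eq (hx ▸ hprime)
  have hcomap := comap_colon_reesSubmodule (W := I • ⊤) (single_mem_reesModule hyk)
  rw [← mul_smul, ← pow_succ, hy, hx] at hcomap
  obtain ⟨q, hq, hqp⟩ := Ideal.exists_minimalPrimes_comap_eq (algebraMap R (reesAlgebra I))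
    p.asIdeal (by rw [hcomap, Ideal.minimalPrimes_eq_subsingleton_self]; rfl)
  exact ⟨q, mem_associatedPrimes_of_mem_minimalPrimes_colon hq, hqp⟩

end AssociatedPrimes

section Localization

open Polynomial Filter

variable {R : Type*} [CommRing R] {M : Type*} [AddCommGroup M] [Module R M] {I J K : Ideal R}
  {S : Submonoid R}

lemma localized_top : (⊤ : Submodule R M).localized S = ⊤ :=
  Submodule.localized'_top ..

lemma localized_smul (S : Submonoid R) (J : Ideal R) (W : Submodule R M) :
    (J • W).localized S = J.map (algebraMap R (Localization S)) • W.localized S := by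
  rw [← Ideal.localized'_eq_map (Localization S) S]
  exact Submodule.localized'_smul ..

lemma localized_pow_smul_top (S : Submonoid R) (I : Ideal R) (n : ℕ) :
    (I ^ n • (⊤ : Submodule R M)).localized S =
      I.map (algebraMap R (Localization S)) ^ n • ⊤ := by
  rw [localized_smul, Ideal.map_pow, localized_top]

lemma localized_le_localized_iff {P Q : Submodule R M} :
    P.localized S ≤ Q.localized S ↔ ∀ x ∈ P, ∃ s : S, s • x ∈ Q := by
  rw [Submodule.localized, Submodule.localized'_eq_span, Submodule.span_le]
  refine ⟨fun h x hx => mkLinearMap_mem_localized.1 (h ⟨x, hx, rfl⟩), ?_⟩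
  rintro h _ ⟨x, hx, rfl⟩
  exact mkLinearMap_mem_localized.2 (h x hx)

lemma localized_mono {P Q : Submodule R M} (h : P ≤ Q) : P.localized S ≤ Q.localized S :=
  localized_le_localized_iff.2 fun x hx => ⟨1, by simpa using h hx⟩

lemma isReduction_map_iff (h : K ≤ J) :
    IsReduction (K.map (algebraMap R (Localization S))) (J.map (algebraMap R (Localization S)))
      (LocalizedModule S M) ↔
    ∃ n, ∀ x ∈ J ^ (n + 1) • (⊤ : Submodule R M), ∃ s : S,
      s • x ∈ K • J ^ n • (⊤ : Submodule R M) := by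
  simp only [← localized_le_localized_iff, localized_smul S K, localized_pow_smul_top]
  exact ⟨fun h => h.exists_pow_smul_le, fun hn => ⟨Ideal.map_mono h, hn⟩⟩

lemma exists_span_map_eq {A : Type*} [CommRing A] [Algebra R A] [IsLocalization S A]
    {t : Finset A} (ht : Ideal.span (t : Set A) ≤ J.map (algebraMap R A)) :
    ∃ s : Finset R, s.card ≤ t.card ∧ Ideal.span (s : Set R) ≤ J ∧
      (Ideal.span (s : Set R)).map (algebraMap R A) = Ideal.span (t : Set A) := by
  classical
  have hnum (z : t) : ∃ y ∈ J, Ideal.span {algebraMap R A y} = Ideal.span {z.1} := by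
    obtain ⟨⟨y, c⟩, hyc⟩ := (IsLocalization.mem_map_algebraMap_iff S A).1
      (ht (Ideal.subset_span z.2))
    exact ⟨y, y.2, hyc ▸ Ideal.span_singleton_mul_right_unit (IsLocalization.map_units A c) _⟩
  choose y hyJ hy using hnum
  refine ⟨Finset.univ.image y, Finset.card_image_le.trans (by simp), ?_, ?_⟩
  · rw [Ideal.span_le]
    simpa [Set.range_subset_iff] using fun z hz => hyJ ⟨z, hz⟩
  · calc (Ideal.span ((Finset.univ.image y : Finset R) : Set R)).map (algebraMap R A)
        = Submodule.span A (Set.range fun z : t => algebraMap R A (y z)) := by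
          rw [Ideal.map_span, Finset.coe_image, Finset.coe_univ, Set.image_univ, ← Set.range_comp]
          rfl
      _ = Submodule.span A (Set.range (Subtype.val : t → A)) := by
          rw [Submodule.span_range_eq_iSup, Submodule.span_range_eq_iSup]
          exact iSup_congr hy
      _ = Ideal.span (t : Set A) := by rw [Subtype.range_val]

lemma map_le_maximalIdeal {p : Ideal R} [p.IsPrime] (h : I ≤ p) :
    I.map (algebraMap R (Localization.AtPrime p)) ≤
      IsLocalRing.maximalIdeal (Localization.AtPrime p) :=
  (Ideal.map_mono h).trans_eq Localization.AtPrime.map_eq_maximalIdeal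

lemma primeSocleLen_pow_smul_top (p : PrimeSpectrum R) (I : Ideal R) (n : ℕ) :
    primeSocleLen p (I ^ n • (⊤ : Submodule R M)) =
      socleLen (I.map (algebraMap R (Localization.AtPrime p.asIdeal)) ^ n •
        (⊤ : Submodule (Localization.AtPrime p.asIdeal)
          (LocalizedModule p.asIdeal.primeCompl M))) := by
  rw [primeSocleLen, localized_pow_smul_top]

lemma le_of_mem_associatedPrimes [IsNoetherianRing R] {p : Ideal R}
    (hp : p ∈ associatedPrimes R (M ⧸ (J • (⊤ : Submodule R M)))) : J ≤ p := by
  obtain ⟨-, x, rfl⟩ := mem_associatedPrimes_quotient.1 hp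
  exact fun c hc => Submodule.mem_colon_singleton.2 (Submodule.smul_mem_smul hc trivial)

lemma le_of_mem_stableAss [IsNoetherianRing R] {p : Ideal R} (hp : p ∈ stableAss R M I) :
    I ≤ p := by
  obtain ⟨n, hn⟩ := Eventually.exists hp
  exact hn.isPrime.le_of_pow_le (le_of_mem_associatedPrimes hn)

lemma minimal_associatedPrimes_iff [IsNoetherianRing R] [Module.Finite R M] {p : Ideal R} :
    Minimal (· ∈ associatedPrimes R M) p ↔ p ∈ (Module.annihilator R M).minimalPrimes := by
  have hle {q : Ideal R} (hq : q ∈ associatedPrimes R M) : Module.annihilator R M ≤ q :=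
    Submodule.annihilator_top (R := R) (M := M) ▸ hq.annihilator_le
  have hmin := Module.associatedPrimes.minimalPrimes_annihilator_subset_associatedPrimes R M
  refine ⟨fun hp => ?_, fun hp => ⟨hmin hp, fun q hq hqp => hp.2 ⟨hq.isPrime, hle hq⟩ hqp⟩⟩
  have := hp.prop.isPrime
  obtain ⟨q, hq, hqp⟩ := Ideal.exists_minimalPrimes_le (hle hp.prop)
  rwa [← hqp.antisymm (hp.le_of_le (hmin hq) hqp)]

variable [IsNoetherianRing R] [Module.Finite R M]

lemma exists_isHilbertPolynomial_primeSocleLen (p : PrimeSpectrum R) (I : Ideal R) :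
    ∃ P : ℚ[X],
      IsHilbertPolynomial (fun n => primeSocleLen p (I ^ n • (⊤ : Submodule R M))) P := by
  by_cases hI : I ≤ p.asIdeal
  · simp_rw [primeSocleLen_pow_smul_top]
    obtain ⟨s, hs⟩ := (IsNoetherian.noetherian (I.map (algebraMap R
      (Localization.AtPrime p.asIdeal))))
    obtain ⟨P, -, hP⟩ := exists_isHilbertPolynomial_socleLen (map_le_maximalIdeal hI)
      (N := LocalizedModule p.asIdeal.primeCompl M) (s := s) (hs.symm ▸ IsReduction.refl _)
    exact ⟨P, hP⟩
  · refine ⟨0, Eventually.of_forall fun n => ⟨0, ?_, by simp⟩⟩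
    by_contra h
    exact hI (p.isPrime.le_of_pow_le
      (le_of_mem_associatedPrimes (mem_associatedPrimes_of_primeSocleLen_ne_zero h)))

lemma exists_isReduction_map_of_analyticSpread_le {p : PrimeSpectrum R} {d : ℕ}
    (h : analyticSpread R M I ≤ d) (hp : p.asIdeal ∈ stableAss R M I) :
    ∃ e ≠ 0, ∃ s : Finset R, s.card ≤ d ∧
      IsReduction ((Ideal.span (s : Set R)).map (algebraMap R (Localization.AtPrime p.asIdeal)))
        ((I ^ e).map (algebraMap R (Localization.AtPrime p.asIdeal)))
        (LocalizedModule p.asIdeal.primeCompl M) := by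
  have hI := le_of_mem_stableAss hp
  rw [analyticSpread] at h
  split_ifs at h with hR
  · obtain ⟨e, he, s, hsd, hs⟩ := exists_isReduction_of_localAnalyticSpread_le
      (hI.trans (IsLocalRing.le_maximalIdeal p.2.ne_top)) h
    obtain ⟨n, hn⟩ := hs.exists_pow_smul_le
    exact ⟨e, he, s, hsd, (isReduction_map_iff hs.le).2
      ⟨n, fun x hx => ⟨1, by simpa using hn hx⟩⟩⟩
  · obtain ⟨m, hm, hpm⟩ := p.asIdeal.exists_le_maximal p.2.ne_top
    have hmax := (le_iSup (fun m : {m : MaximalSpectrum R //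
      ∃ p ∈ stableAss R M I, p ≤ m.asIdeal} => localAnalyticSpread
        (Localization.AtPrime m.1.asIdeal) (LocalizedModule.AtPrime m.1.asIdeal M)
        (I.map (algebraMap R (Localization.AtPrime m.1.asIdeal)))) ⟨⟨m, hm⟩, _, hp, hpm⟩).trans h
    have := hm.isPrime
    obtain ⟨e, he, t, htd, ht⟩ :=
      exists_isReduction_of_localAnalyticSpread_le (map_le_maximalIdeal (hI.trans hpm)) hmax
    rw [← Ideal.map_pow] at ht
    obtain ⟨s, hst, hsI, hs⟩ := exists_span_map_eq (S := m.primeCompl) ht.le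
    obtain ⟨n, hn⟩ := (isReduction_map_iff hsI).1 (hs ▸ ht)
    refine ⟨e, he, s, hst.trans htd, (isReduction_map_iff hsI).2 ⟨n, fun x hx => ?_⟩⟩
    obtain ⟨c, hc⟩ := hn x hx
    exact ⟨⟨c, fun hcp => c.2 (hpm hcp)⟩, hc⟩

omit [Module.Finite R M] in
lemma mem_stableAss_of_isHilbertPolynomial {p : PrimeSpectrum R} {P : ℚ[X]} (h0 : P ≠ 0)
    (hP : IsHilbertPolynomial (fun n => primeSocleLen p (I ^ n • (⊤ : Submodule R M))) P) :
    p.asIdeal ∈ stableAss R M I := by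
  have hroots : ∀ᶠ n : ℕ in atTop, P.eval (n : ℚ) ≠ 0 := by
    rw [← Nat.cofinite_eq_atTop, eventually_cofinite]
    simp only [not_not]
    exact (finite_setOfPred_isRoot h0).preimage Nat.cast_injective.injOn
  filter_upwards [hroots, hP] with n hn ⟨k, hk, hkP⟩
  refine mem_associatedPrimes_of_primeSocleLen_ne_zero fun h => hn ?_
  obtain rfl : k = 0 := by exact_mod_cast hk.symm.trans h
  exact_mod_cast hkP.symm

lemma degree_lt_of_analyticSpread_le {p : PrimeSpectrum R} {d : ℕ} (hd : d ≠ 0)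
    (h : analyticSpread R M I ≤ d) {P : ℚ[X]}
    (hP : IsHilbertPolynomial (fun n => primeSocleLen p (I ^ n • (⊤ : Submodule R M))) P) :
    P.degree < d := by
  classical
  obtain rfl | h0 := eq_or_ne P 0
  · exact degree_zero.trans_lt (WithBot.bot_lt_coe d)
  have hp := mem_stableAss_of_isHilbertPolynomial h0 hP
  have hI := le_of_mem_stableAss hp
  obtain ⟨e, he, s, hsd, hs⟩ := exists_isReduction_map_of_analyticSpread_le h hp
  simp_rw [primeSocleLen_pow_smul_top] at hP
  rw [Ideal.map_span, ← Finset.coe_image, Ideal.map_pow] at hs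
  refine (degree_lt_of_isReduction (map_le_maximalIdeal hI) hP he hs).trans_le ?_
  exact_mod_cast max_le (Finset.card_image_le.trans hsd) (Nat.one_le_iff_ne_zero.2 hd)

lemma supportDim_le_of_polyBounded_primeSocleLen {p : PrimeSpectrum R}
    (hp : Minimal (fun q : Ideal R => q ∈ associatedPrimes R (M ⧸ (I • (⊤ : Submodule R M))))
      p.asIdeal) {d : ℕ}
    (h : PolyBounded d fun n => primeSocleLen p (I ^ n • (⊤ : Submodule R M))) :
    Module.supportDim (Localization.AtPrime p.asIdeal)
      (LocalizedModule.AtPrime p.asIdeal M) ≤ d := by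
  set A := Module.annihilator R (M ⧸ (I • (⊤ : Submodule R M)))
  have hA : A • (⊤ : Submodule R M) ≤ I • ⊤ := Submodule.smul_le.2 fun c hc x _ =>
    (Submodule.Quotient.mk_eq_zero _).1 (Module.mem_annihilator.1 hc (Submodule.Quotient.mk x))
  obtain ⟨s, hs⟩ := Ideal.exists_pow_le_of_le_radical_of_fg
    (IsLocalization.AtPrime.radical_map_of_mem_minimalPrimes (Localization.AtPrime p.asIdeal)
      p.asIdeal A (minimal_associatedPrimes_iff.1 hp)).ge (IsNoetherian.noetherian _)
  rw [Localization.AtPrime.map_eq_maximalIdeal] at hs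
  simp_rw [primeSocleLen_pow_smul_top] at h
  refine supportDim_le_of_polyBounded_socleLen
    (map_le_maximalIdeal (le_of_mem_associatedPrimes hp.prop)) (s := s)
    ((Submodule.smul_mono_left hs).trans ?_) h
  have hloc := localized_mono (S := p.asIdeal.primeCompl) hA
  rwa [localized_smul, localized_smul, localized_top] at hloc

end Localization

section IrPolynomial

open Polynomial Filter

lemma exists_eq_natCast_of_one_le {x : WithBot ℕ∞} (h₁ : 1 ≤ x) (h : x < ⊤) :
    ∃ d : ℕ, d ≠ 0 ∧ x = d := by
  lift x to ℕ∞ using ne_bot_of_le_ne_bot (by decide) h₁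
  lift x to ℕ using fun hx => h.ne (congrArg _ hx)
  refine ⟨x, ?_, rfl⟩
  rintro rfl
  exact absurd h₁ (by decide)

variable {R : Type*} [CommRing R] {M : Type*} [AddCommGroup M] [Module R M] {I : Ideal R}

lemma isIrPolynomial_iff {P : ℚ[X]} : IsIrPolynomial R M I P ↔
    IsHilbertPolynomial (fun n => (ir (I ^ n • (⊤ : Submodule R M)) : ℕ∞)) P :=
  eventually_congr (Eventually.of_forall fun n =>
    ⟨fun h => ⟨_, rfl, h⟩, fun ⟨_, hk, hkP⟩ => by rwa [ENat.natCast_inj.1 hk]⟩)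

variable [IsNoetherianRing R] [Module.Finite R M]

lemma primeSocleLen_le_ir (p : PrimeSpectrum R) (N : Submodule R M) :
    primeSocleLen p N ≤ ir N := by
  classical
  have hfin : {q : PrimeSpectrum R | q.asIdeal ∈ associatedPrimes R (M ⧸ N)}.Finite :=
    (associatedPrimes.finite R (M ⧸ N)).preimage
      (f := PrimeSpectrum.asIdeal) fun _ _ _ _ h => PrimeSpectrum.ext h
  rw [ir_eq_sum_primeSocleLen N (F := insert p hfin.toFinset) fun q hq =>
    Finset.mem_insert_of_mem (hfin.mem_toFinset.2 hq)]
  exact Finset.single_le_sum (f := fun q => primeSocleLen q N) (fun _ _ => zero_le)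
    (Finset.mem_insert_self _ _)

lemma exists_isIrPolynomial_degree_lt {d : ℕ} (hd : d ≠ 0) (h : analyticSpread R M I ≤ d) :
    ∃ P : ℚ[X], P.degree < d ∧ IsIrPolynomial R M I P := by
  have hfin := finite_setOf_mem_associatedPrimes_pow (M := M) I
  choose P hP using fun p => exists_isHilbertPolynomial_primeSocleLen (M := M) p I
  refine ⟨∑ p ∈ hfin.toFinset, P p, ?_, isIrPolynomial_iff.2 ?_⟩
  · exact mem_degreeLT.1 (Submodule.sum_mem _ fun p _ =>
      mem_degreeLT.2 (degree_lt_of_analyticSpread_le hd h (hP p)))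
  · refine (IsHilbertPolynomial.sum fun p _ => hP p).congr (Eventually.of_forall fun n => ?_)
    exact (ir_eq_sum_primeSocleLen _ fun p hp => hfin.mem_toFinset.2 ⟨n, hp⟩).symm

lemma supportDim_le_of_isIrPolynomial {p : PrimeSpectrum R}
    (hp : Minimal (fun q : Ideal R => q ∈ associatedPrimes R (M ⧸ (I • (⊤ : Submodule R M))))
      p.asIdeal) {P : ℚ[X]} (hP : IsIrPolynomial R M I P) {d : ℕ} (hd : P.degree < d) :
    Module.supportDim (Localization.AtPrime p.asIdeal)
      (LocalizedModule.AtPrime p.asIdeal M) ≤ d :=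
  supportDim_le_of_polyBounded_primeSocleLen hp (((isIrPolynomial_iff.1 hP).polyBounded hd).mono
    (Eventually.of_forall fun _ => primeSocleLen_le_ir p _))

theorem exists_isIrPolynomial_of_analyticSpread_le_supportDim {p : PrimeSpectrum R}
    (hp : Minimal (fun q : Ideal R => q ∈ associatedPrimes R (M ⧸ (I • (⊤ : Submodule R M))))
      p.asIdeal) (h₁ : 1 ≤ analyticSpread R M I)
    (h : analyticSpread R M I ≤ Module.supportDim (Localization.AtPrime p.asIdeal)
      (LocalizedModule.AtPrime p.asIdeal M)) :
    ∃ P : ℚ[X], IsIrPolynomial R M I P ∧ P ≠ 0 ∧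
      (P.natDegree : WithBot ℕ∞) + 1 = analyticSpread R M I := by
  have hfin : analyticSpread R M I < ⊤ :=
    h.trans_lt ((Module.supportDim_le_ringKrullDim _ _).trans_lt ringKrullDim_lt_top)
  obtain ⟨d, hd, hspread⟩ := exists_eq_natCast_of_one_le h₁ hfin
  obtain ⟨P, hPd, hP⟩ := exists_isIrPolynomial_degree_lt hd hspread.le
  have hle {k : ℕ} (hk : P.degree < k) : d ≤ k := by
    exact_mod_cast hspread.ge.trans (h.trans (supportDim_le_of_isIrPolynomial hp hP hk))
  have h0 : P ≠ 0 := fun h0 => hd (Nat.le_zero.1 (hle (by simp [h0])))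
  refine ⟨P, hP, h0, ?_⟩
  have hdeg : P.natDegree + 1 = d := le_antisymm ((natDegree_lt_iff_degree_lt h0).2 hPd)
    (hle ((natDegree_lt_iff_degree_lt h0).1 P.natDegree.lt_succ_self))
  rw [hspread, ← hdeg, Nat.cast_succ]

lemma exists_supportDim_eq_bight (h : bight R M I ≠ ⊥) :
    ∃ p : PrimeSpectrum R,
      Minimal (fun q : Ideal R => q ∈ associatedPrimes R (M ⧸ (I • (⊤ : Submodule R M))))
        p.asIdeal ∧
      Module.supportDim (Localization.AtPrime p.asIdeal) (LocalizedModule.AtPrime p.asIdeal M) =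
        bight R M I := by
  let ι := {p : PrimeSpectrum R //
    Minimal (fun q : Ideal R => q ∈ associatedPrimes R (M ⧸ (I • (⊤ : Submodule R M)))) p.asIdeal}
  have : Finite ι := ((associatedPrimes.finite R (M ⧸ (I • (⊤ : Submodule R M)))).preimage
    (f := PrimeSpectrum.asIdeal) fun _ _ _ _ h => PrimeSpectrum.ext h).subset fun p hp => hp.1
  have : Nonempty ι := by
    by_contra hι
    rw [not_nonempty_iff] at hι
    exact h (iSup_of_empty _)
  obtain ⟨p, hp⟩ := exists_eq_ciSup_of_finite (f := fun p : ι =>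
    Module.supportDim (Localization.AtPrime p.1.asIdeal) (LocalizedModule.AtPrime p.1.asIdeal M))
  exact ⟨p.1, p.2, hp⟩

end IrPolynomial

section Equimultiple

variable {R : Type*} [CommRing R] {I : Ideal R}

lemma analyticSpread_top [IsLocalRing R] {M : Type*} [AddCommGroup M] [Module R M] :
    analyticSpread R M ⊤ = ⊥ := by
  have h : Subsingleton (GrRing R ⊤) :=
    Ideal.Quotient.subsingleton_iff.2 (Ideal.map_top (algebraMap R (reesAlgebra ⊤)))
  have := Module.subsingleton (GrRing R ⊤) (GrModule R M ⊤ ⧸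
    grExt M ⊤ (IsLocalRing.maximalIdeal R))
  rw [analyticSpread, dif_pos ‹_›]
  exact Module.supportDim_eq_bot_of_subsingleton _ _

lemma IsEquimultiple.ne_top [IsLocalRing R] (h : IsEquimultiple R I) : I ≠ ⊤ := by
  rintro rfl
  rw [IsEquimultiple, analyticSpread_top] at h
  exact WithBot.bot_ne_coe h

lemma supportDim_localization_self (p : PrimeSpectrum R) :
    Module.supportDim (Localization.AtPrime p.asIdeal) (LocalizedModule.AtPrime p.asIdeal R) =
      p.asIdeal.height := by
  rw [← IsLocalization.AtPrime.ringKrullDim_eq_height p.asIdeal (Localization.AtPrime p.asIdeal),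
    ← Module.supportDim_self_eq_ringKrullDim]

lemma minimal_associatedPrimes_of_mem_minimalPrimes [IsNoetherianRing R] {p : Ideal R}
    (hp : p ∈ I.minimalPrimes) :
    Minimal (fun q : Ideal R => q ∈ associatedPrimes R (R ⧸ (I • (⊤ : Submodule R R)))) p := by
  refine minimal_associatedPrimes_iff.2 ?_
  rwa [smul_eq_mul, Ideal.mul_top, Ideal.annihilator_quotient]

theorem exists_isIrPolynomial_of_isEquimultiple [IsNoetherianRing R] [IsLocalRing R]
    (h₁ : 1 ≤ I.height) (h : IsEquimultiple R I) :
    ∃ P : Polynomial ℚ, IsIrPolynomial R R I P ∧ P ≠ 0 ∧ (P.natDegree : ℕ∞) + 1 = I.height := by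
  obtain ⟨p, hp⟩ := Ideal.nonempty_minimalPrimes h.ne_top
  rw [IsEquimultiple] at h
  have hdim := supportDim_localization_self ⟨p, hp.isPrime⟩
  obtain ⟨P, hP, h0, hdeg⟩ := exists_isIrPolynomial_of_analyticSpread_le_supportDim
    (minimal_associatedPrimes_of_mem_minimalPrimes hp) (h ▸ WithBot.coe_le_coe.2 h₁)
    (h.trans_le ((WithBot.coe_le_coe.2 (Ideal.height_mono hp.le)).trans hdim.ge))
  exact ⟨P, hP, h0, by exact_mod_cast hdeg.trans h⟩

end Equimultiple

end IrPoly

theorem corollary4p3 :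
    (∀ (R : Type u) [CommRing R] [IsNoetherianRing R]
        (M : Type v) [AddCommGroup M] [Module R M] [Module.Finite R M] (I : Ideal R),
        1 ≤ IrPoly.analyticSpread R M I →
        IrPoly.analyticSpread R M I = IrPoly.bight R M I →
        ∃ P : Polynomial ℚ, IrPoly.IsIrPolynomial R M I P ∧ P ≠ 0 ∧
          (P.natDegree : WithBot ℕ∞) + 1 = IrPoly.analyticSpread R M I) ∧
    (∀ (R : Type u) [CommRing R] [IsNoetherianRing R] [IsLocalRing R] (I : Ideal R),
        1 ≤ I.height →
        IrPoly.IsEquimultiple R I →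
        ∃ P : Polynomial ℚ, IrPoly.IsIrPolynomial R R I P ∧ P ≠ 0 ∧
          (P.natDegree : ℕ∞) + 1 = I.height) := by
  refine ⟨fun R _ _ M _ _ _ I h₁ h => ?_, fun R _ _ _ I h₁ h =>
    IrPoly.exists_isIrPolynomial_of_isEquimultiple h₁ h⟩
  have hbight : IrPoly.bight R M I ≠ ⊥ := ne_bot_of_le_ne_bot (by decide) (h₁.trans h.le)
  obtain ⟨p, hp, hdim⟩ := IrPoly.exists_supportDim_eq_bight hbight
  exact IrPoly.exists_isIrPolynomial_of_analyticSpread_le_supportDim hp h₁ (h.trans hdim.symm).le
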